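/- A \emph{pattern} $\widehat F$ of $K_k$ is a partition of the edge set of $K_k$. For a graph $G$, let $c_{3,\widehat F}(G)$ be the number of (not necessarily proper) colorings of the edges of $G$ with colors from a fixed set of $3$ colors that are \emph{$\widehat F$-free}, that is, for which there is no copy of $K_k$ in $G$ whose edges, partitioned according to their colors, form a partition isomorphic to $\widehat F$ (the names of the colors are ignored). Let $c_{3,\widehat F}(n)$ be the maximum of $c_{3,\widehat F}(G)$ over all $n$-vertex graphs $G$. Let $\mathrm{ex}(n,K_k)$ be the maximum number of edges of a $K_k$-free graph on $n$ vertices, and let $T_{k-1}(n)$ be the Tur\'an graph, the complete $(k-1)$-partite graph on $n$ vertices with parts of sizes as equal as possible (some parts are empty if $n<k-1$). A pattern $\widehat F$ of $K_k$ satisfies the \emph{$3$-stability property} if it has at most $3$ classes and, for every $\delta>0$, there is an $n_0$ such that every graph $G$ on $n>n_0$ vertices with $c_{3,\widehat F}(G)\ge 3^{\mathrm{ex}(n,K_k)}$ has a partition $V(G)=V_1\cup\dots\cup V_{k-1}$ of its vertex set (parts may be empty) with $\sum_{i=1}^{k-1} e(V_i)\le \delta n^2$, where $e(V_i)$ is the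 number of edges of $G$ with both ends in $V_i$. \textbf{Lemma.} Let $k\ge 3$ and let $\widehat F$ be a pattern of $K_k$ that satisfies the $3$-stability property. Then there is an $n_1$ (depending on $\widehat F$) such that for every $n\ge n_1$ and every graph $G$ on $n$ vertices, $c_{3,\widehat F}(G)=c_{3,\widehat F}(n)$ if and only if $G$ is isomorphic to $T_{k-1}(n)$. -/

import Mathlib

/-- A pattern of a graph `F`: a partition of the edge set of `F`, given as an equivalence relation
on the edges. The classes are not named. -/
abbrev EdgePattern {W : Type*} (F : SimpleGraph W) := Setoid F.edgeSet

/-- The number of classes of a pattern. -/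
noncomputable def EdgePattern.numClasses {W : Type*} {F : SimpleGraph W} (P : EdgePattern F) : ℕ :=
  Nat.card (Quotient P)

/-- The edge colouring `C` of `G` contains the pattern `P` of `F`: there is a (not necessarily
induced) copy of `F` in `G` on which two edges receive the same colour exactly when the
corresponding edges of `F` lie in the same class of `P`. -/
def ContainsPattern {W V K : Type*} {F : SimpleGraph W} {G : SimpleGraph V}
    (P : EdgePattern F) (C : G.EdgeLabeling K) : Prop :=
  ∃ f : F.Copy G, ∀ e e' : F.edgeSet,
    P e e' ↔ C (f.toHom.mapEdgeSet e) = C (f.toHom.mapEdgeSet e')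

/-- The number of (not necessarily proper) `r`-colourings of the edges of `G` that do not contain
the pattern `P`. -/
noncomputable def patternFreeCount {W V : Type*} {F : SimpleGraph W} (r : ℕ) (P : EdgePattern F)
    (G : SimpleGraph V) : ℕ :=
  Nat.card {C : G.EdgeLabeling (Fin r) // ¬ ContainsPattern P C}

/-- The maximum of `patternFreeCount r P G` over all graphs `G` on `n` vertices. -/
noncomputable def maxPatternFreeCount {W : Type*} {F : SimpleGraph W} (r : ℕ) (P : EdgePattern F)
    (n : ℕ) : ℕ :=
  ⨆ G : SimpleGraph (Fin n), patternFreeCount r P G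

/-- The supremum above is a maximum. -/
theorem isGreatest_maxPatternFreeCount {W : Type*} {F : SimpleGraph W} (r : ℕ) (P : EdgePattern F)
    (n : ℕ) :
    IsGreatest (Set.range fun G : SimpleGraph (Fin n) => patternFreeCount r P G)
      (maxPatternFreeCount r P n) := by
  have hb : BddAbove (Set.range fun G : SimpleGraph (Fin n) => patternFreeCount r P G) :=
    (Set.finite_range _).bddAbove
  exact ⟨Nat.sSup_mem (Set.range_nonempty _) hb, fun x hx => le_csSup hb hx⟩

/-- The `3`-stability property of a pattern of `K_k`. A partition of the vertices into (possibly
empty) classes `V_1, …, V_{k-1}` is given as a function `p` to `Fin (k - 1)`. -/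
def ThreeStability {k : ℕ} (P : EdgePattern (⊤ : SimpleGraph (Fin k))) : Prop :=
  P.numClasses ≤ 3 ∧
    ∀ δ : ℝ, 0 < δ → ∃ n₀ : ℕ, ∀ n : ℕ, n₀ < n → ∀ G : SimpleGraph (Fin n),
      3 ^ SimpleGraph.extremalNumber n (⊤ : SimpleGraph (Fin k)) ≤ patternFreeCount 3 P G →
        ∃ p : Fin n → Fin (k - 1),
          ((∑ i, (G.induce {v | p v = i}).edgeSet.ncard : ℕ) : ℝ) ≤ δ * (n : ℝ) ^ 2

/-!
Write `k = r + 1`, `t(n) = ex(n, K_k)`, and `c(G)` for the number of pattern-free 3-colourings of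
`G`. An `r`-partite graph contains no `K_k`, so `c(G) = 3 ^ e(G)` and, by Turán's theorem, only the
Turán graph reaches `3 ^ t(n)` among the `r`-partite graphs. The point is therefore that a large
graph with `c(G) ≥ 3 ^ t(n)` is `r`-partite.

Suppose it is not, and `c(G) ≥ 3 ^ (t(n) + m)`. Then one or two vertices can be removed so that the
remaining graph, on `n'` vertices, satisfies `c(G') ≥ 3 ^ (t(n') + m + 1)`
(`exists_smaller_of_partition`). The new graph is not `r`-partite either, as it beats the Turán
graph, so the step can be repeated until boundedly many vertices are left. By then `m` has grown
linearly in the original `n`, which contradicts the trivial bound `c(G) ≤ 3 ^ e(G)`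
(`two_mul_add_le_of_pow_le`).

For the step, stability gives a partition with `o(n ^ 2)` inner edges; take one with the fewest. As
`e(G) ≥ t(n)`, its classes have nearly equal sizes and few edges between them are missing. Hence all
but a tiny proportion of the colourings are generic: every colour has positive density between any
two linear-sized sets in different classes (`card_not_isGeneric_le`). In a generic colouring,
vertices with prescribed colours between them can be chosen greedily from linear-sized sets in
different classes (`IsGeneric.exists_transversal`), so a pattern-free generic colouring is
restricted at every vertex and at every inner edge:

* If some vertex `x` has linearly many neighbours in its own class, then it has as many in every
  class, by minimality. Let `S i` be the set of frequent colours from `x` to the class `i`. If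
  `∏ i, #(S i) ≥ 3 ^ (r - 1)`, then at most two of the sets are not full, and the star at a vertex of
  the pattern can be coloured from them (`exists_injective_classes_star`). So the product is smaller,
  and the edges at `x` have exponentially fewer than `3 ^ ((1 - 1 / r) n)` colourings
  (`card_generic_le_of_vertex`).
* Otherwise there is an inner edge `xy` whose ends have few neighbours in their own class. For some
  other class one of the nine colour pairs is rare on the edges from `x` and `y` to it, which saves
  a factor exponential in `n` compared with `3 ^ (2 (1 - 1 / r) n)` (`card_generic_le_of_edge`).

Since `t(n) - t(n - d)` is `d (1 - 1 / r) n` up to a constant, the exponential saving more than pays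
for the additional factor of 3. The counts of colourings in which certain colours are rare all come
from the exponential-moment bound `card_rare_le`.
-/

section PatternFreeColourings

open Finset Function Filter Topology
open scoped Classical

/-! ### Pattern-free colourings: basic facts -/

theorem ContainsPattern.comp {W V V' K : Type*} {F : SimpleGraph W} {G : SimpleGraph V}
    {G' : SimpleGraph V'} {P : EdgePattern F} {C : G.EdgeLabeling K} (f : G'.Copy G)
    (h : ContainsPattern P (C.pullback f.toHom)) : ContainsPattern P C := by
  obtain ⟨g, hg⟩ := h
  refine ⟨f.comp g, fun e e' => (hg e e').trans ?_⟩
  obtain ⟨e, he⟩ := e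
  obtain ⟨e', he'⟩ := e'
  induction e using Sym2.inductionOn
  induction e' using Sym2.inductionOn
  exact Iff.rfl

theorem patternFreeCount_le_of_iso {W V V' : Type*} {F : SimpleGraph W} [Finite V] {r : ℕ}
    {P : EdgePattern F} {G : SimpleGraph V} {G' : SimpleGraph V'} (f : G' ≃g G) :
    patternFreeCount r P G' ≤ patternFreeCount r P G := by
  have hinj : Injective (fun C : {C : G'.EdgeLabeling (Fin r) // ¬ ContainsPattern P C} =>
      (⟨C.1.pullback f.symm.toCopy.toHom, fun h => C.2 (h.comp f.symm.toCopy)⟩ :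
        {C : G.EdgeLabeling (Fin r) // ¬ ContainsPattern P C})) := by
    intro C C' h
    apply Subtype.ext
    have h' := congrArg Subtype.val h
    funext e
    have := congrFun h' (f.mapEdgeSet e)
    have he : f.symm.toCopy.toHom.mapEdgeSet (f.mapEdgeSet e) = e :=
      f.mapEdgeSet.symm_apply_apply e
    change C.1 (f.symm.toCopy.toHom.mapEdgeSet (f.mapEdgeSet e)) =
      C'.1 (f.symm.toCopy.toHom.mapEdgeSet (f.mapEdgeSet e)) at this
    rwa [he] at this
  exact Nat.card_le_card_of_injective _ hinj

theorem patternFreeCount_congr {W V V' : Type*} {F : SimpleGraph W} [Finite V] [Finite V'] {r : ℕ}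
    {P : EdgePattern F} {G : SimpleGraph V} {G' : SimpleGraph V'} (f : G' ≃g G) :
    patternFreeCount r P G' = patternFreeCount r P G :=
  le_antisymm (patternFreeCount_le_of_iso f) (patternFreeCount_le_of_iso f.symm)

theorem card_edgeLabeling {V : Type*} [Fintype V] (G : SimpleGraph V) (r : ℕ) :
    Nat.card (G.EdgeLabeling (Fin r)) = r ^ #G.edgeFinset := by
  rw [show Nat.card (G.EdgeLabeling (Fin r)) = Nat.card (G.edgeSet → Fin r) from rfl, Nat.card_fun]
  simp [SimpleGraph.edgeFinset_card]

theorem patternFreeCount_le {W V : Type*} {F : SimpleGraph W} [Fintype V] (r : ℕ)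
    (P : EdgePattern F) (G : SimpleGraph V) :
    patternFreeCount r P G ≤ r ^ #G.edgeFinset := by
  rw [← card_edgeLabeling]
  exact Nat.card_le_card_of_injective _ Subtype.val_injective

/-- Every colouring of an `F`-free graph avoids each pattern of `F`. -/
theorem patternFreeCount_of_free {W V : Type*} {F : SimpleGraph W} [Fintype V] (r : ℕ)
    (P : EdgePattern F) {G : SimpleGraph V} (hG : F.Free G) :
    patternFreeCount r P G = r ^ #G.edgeFinset := by
  rw [← card_edgeLabeling]
  exact Nat.card_congr (Equiv.subtypeUnivEquiv fun C h => hG ⟨h.choose⟩)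

theorem patternFreeCount_eq_card {W V : Type*} {F : SimpleGraph W} [Fintype V] (r : ℕ)
    (P : EdgePattern F) (G : SimpleGraph V) :
    patternFreeCount r P G = #{C : G.EdgeLabeling (Fin r) | ¬ ContainsPattern P C} := by
  rw [patternFreeCount, Nat.card_eq_fintype_card, Fintype.card_subtype]

/-- A colouring contains a pattern of `K_k` as soon as the colours prescribed by some injection
`τ` of the classes into the colours occur on some family of vertices. -/
theorem containsPattern_of_labelGraph_adj {V K : Type*} {k : ℕ} {G : SimpleGraph V}
    {P : EdgePattern (⊤ : SimpleGraph (Fin k))} {C : G.EdgeLabeling K} {τ : Quotient P → K}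
    (hτ : Injective τ) (f : Fin k → V)
    (hf : ∀ a b (h : a ≠ b), (C.labelGraph (τ ⟦⟨s(a, b), h⟩⟧)).Adj (f a) (f b)) :
    ContainsPattern P C := by
  have hadj : ∀ a b, a ≠ b → G.Adj (f a) (f b) := fun a b h => C.labelGraph_le (hf a b h)
  have hcol : ∀ e : (⊤ : SimpleGraph (Fin k)).edgeSet,
      C (SimpleGraph.Hom.mapEdgeSet (⟨f, fun {a b} h => hadj a b h⟩ : ⊤ →g G) e) =
        τ ⟦e⟧ := by
    rintro ⟨e, he⟩
    induction e using Sym2.inductionOn with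
    | _ a b => exact (SimpleGraph.EdgeLabeling.labelGraph_adj _ _).1 (hf a b he) |>.choose_spec
  refine ⟨⟨⟨f, fun {a b} h => hadj a b h⟩, fun a b hab => ?_⟩, fun e e' => ?_⟩
  · by_contra h
    exact (hadj a b h).ne hab
  · rw [hcol, hcol]
    exact Quotient.eq.symm.trans hτ.eq_iff.symm

/-- Colourings are determined by their restriction to `G - D` together with the colours of the
edges that meet `D`. -/
theorem card_le_patternFreeCount_induce_mul {W V β : Type*} {F : SimpleGraph W} [Fintype V]
    [DecidableEq β]
    {r : ℕ} {P : EdgePattern F} {G : SimpleGraph V} (D : Set V)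
    (𝓕 : Finset (G.EdgeLabeling (Fin r))) (h𝓕 : ∀ C ∈ 𝓕, ¬ ContainsPattern P C)
    (Φ : G.EdgeLabeling (Fin r) → β)
    (hΦ : ∀ C C' : G.EdgeLabeling (Fin r), Φ C = Φ C' → ∀ x ∈ D, ∀ y (h : G.Adj x y),
      C.get x y h = C'.get x y h) :
    #𝓕 ≤ patternFreeCount r P (G.induce Dᶜ) * #(𝓕.image Φ) := by
  let ψ : (G.induce Dᶜ).Copy G := (SimpleGraph.Embedding.induce (G := G) Dᶜ).toCopy
  rw [patternFreeCount_eq_card, ← card_product]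
  refine card_le_card_of_injOn (fun C => (C.pullback ψ.toHom, Φ C)) ?_ ?_
  · intro C hC
    have hC' : C ∈ 𝓕 := hC
    simp only [coe_product, Set.mem_prod, mem_coe, mem_filter, mem_univ, true_and]
    exact ⟨fun h => h𝓕 C hC' (h.comp ψ), mem_image_of_mem _ hC'⟩
  · intro C _ C' _ h
    simp only [Prod.mk.injEq] at h
    apply SimpleGraph.EdgeLabeling.ext_get
    intro x y hxy
    by_cases hx : x ∈ D
    · exact hΦ _ _ h.2 x hx y hxy
    by_cases hy : y ∈ D
    · rw [SimpleGraph.EdgeLabeling.get_comm, SimpleGraph.EdgeLabeling.get_comm (C := C')]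
      exact hΦ _ _ h.2 y hy x hxy.symm
    · exact congrFun h.1 ⟨s(⟨x, hx⟩, ⟨y, hy⟩), hxy⟩

/-! ### Counting functions that rarely take prescribed values -/

/-- An exponential-moment bound: the functions `f` with `f v ∈ T v` that take a value in `R v` at
most `s` times are few, because each of them contributes at least `q ^ s` to the product expansion
of `∏ v, (#(T v \ R v) + q * #(T v ∩ R v))`. -/
theorem card_rare_le {ι κ : Type*} [Fintype ι] [DecidableEq κ] (T R : ι → Finset κ)
    {q s : ℝ} (hq : 0 < q) (hq1 : q ≤ 1) (𝓕 : Finset (ι → κ))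
    (h𝓕 : ∀ f ∈ 𝓕, (∀ v, f v ∈ T v) ∧ (#{v | f v ∈ R v} : ℝ) ≤ s) :
    (#𝓕 : ℝ) ≤ q ^ (-s) * ∏ v, ((#(T v \ R v) : ℝ) + q * #(T v ∩ R v)) := by
  have h1 : ∀ v, (#(T v \ R v) : ℝ) + q * #(T v ∩ R v) =
      ∑ a ∈ T v, if a ∈ R v then q else 1 := by
    intro v
    rw [sum_ite, sum_const, sum_const, filter_mem_eq_inter, filter_notMem_eq_sdiff]
    simp only [nsmul_eq_mul]
    ring
  simp_rw [h1]
  rw [prod_univ_sum, Real.rpow_neg hq.le, ← div_eq_inv_mul, le_div_iff₀ (by positivity)]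
  calc (#𝓕 : ℝ) * q ^ s = ∑ f ∈ 𝓕, q ^ s := by simp
    _ ≤ ∑ f ∈ 𝓕, ∏ v, (if f v ∈ R v then q else 1) := by
        refine sum_le_sum fun f hf => ?_
        rw [prod_ite, prod_const, prod_const_one, mul_one, ← Real.rpow_natCast]
        exact Real.rpow_le_rpow_of_exponent_ge hq hq1 (h𝓕 f hf).2
    _ ≤ _ := by
        refine sum_le_sum_of_subset_of_nonneg
          (fun f hf => Fintype.mem_piFinset.2 (h𝓕 f hf).1) fun f _ _ => ?_
        refine prod_nonneg fun v _ => ?_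
        split_ifs <;> positivity

/-! ### Generic colourings and greedy embedding -/

/-- A colouring is generic with respect to a vertex partition `p` and a threshold `μ` if between
any two sets of at least `μ` vertices in different parts every colour has density more than
`1 / 16`. -/
def IsGeneric {V ι : Type*} {G : SimpleGraph V} (p : V → ι) (μ : ℝ)
    (C : G.EdgeLabeling (Fin 3)) : Prop :=
  ∀ X Y : Finset V, ∀ i j, i ≠ j → (∀ x ∈ X, p x = i) → (∀ y ∈ Y, p y = j) →
    μ ≤ #X → μ ≤ #Y → ∀ c, (#X * #Y : ℝ) < 16 * #((C.labelGraph c).interedges X Y)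

/-- Vertices with prescribed colours between them can be chosen from large sets in different
parts: all but few choices of a vertex keep a sixteenth of each of the remaining sets. -/
theorem IsGeneric.exists_transversal {V ι : Type*} [Nonempty V] {G : SimpleGraph V} {p : V → ι}
    {μ : ℝ} {C : G.EdgeLabeling (Fin 3)} (hC : IsGeneric p μ C) (hμ : 0 < μ) (χ : ι → ι → Fin 3)
    (hχ : ∀ i j, χ i j = χ j i) (I : Finset ι) (A : ι → Finset V)
    (hA : ∀ i ∈ I, ∀ v ∈ A i, p v = i) (hcard : ∀ i ∈ I, 16 ^ #I * μ ≤ #(A i)) :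
    ∃ f : ι → V, (∀ i ∈ I, f i ∈ A i) ∧
      ∀ i ∈ I, ∀ j ∈ I, i ≠ j → (C.labelGraph (χ i j)).Adj (f i) (f j) := by
  induction I using Finset.induction_on generalizing A with
  | empty => exact ⟨fun _ => Classical.arbitrary V, by simp, by simp⟩
  | insert i I hi ih =>
    rw [card_insert_of_notMem hi] at hcard
    let N : ι → V → Finset V := fun j v => {w ∈ A j | (C.labelGraph (χ i j)).Adj v w}
    -- `X j` consists of the choices of a vertex for `i` that leave too little of `A j`.
    let X : ι → Finset V := fun j => {v ∈ A i | 16 * (#(N j v) : ℝ) ≤ #(A j)}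
    have hpow : (1 : ℝ) ≤ 16 ^ (#I + 1) := one_le_pow₀ (by norm_num)
    have hX : ∀ j ∈ I, (#(X j) : ℝ) ≤ μ := by
      intro j hj
      by_contra! h
      have hne : i ≠ j := fun e => hi (e ▸ hj)
      have h1 := hC (X j) (A j) i j hne
        (fun x hx => hA i (mem_insert_self i I) x (mem_filter.1 hx).1)
        (hA j (mem_insert_of_mem hj)) h.le
        (le_trans (by nlinarith) (hcard j (mem_insert_of_mem hj))) (χ i j)
      have h2 : #((C.labelGraph (χ i j)).interedges (X j) (A j)) = ∑ v ∈ X j, #(N j v) := by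
        rw [SimpleGraph.interedges, Rel.interedges, card_filter, sum_product]
        refine sum_congr rfl fun v _ => ?_
        rw [card_filter]
      have h3 : 16 * (#((C.labelGraph (χ i j)).interedges (X j) (A j)) : ℝ) ≤ #(X j) * #(A j) := by
        rw [h2]
        push_cast
        rw [mul_sum]
        calc _ ≤ ∑ v ∈ X j, (#(A j) : ℝ) := sum_le_sum fun v hv => (mem_filter.1 hv).2
          _ = _ := by simp
      linarith
    obtain ⟨v, hv, hvX⟩ : ∃ v ∈ A i, v ∉ I.biUnion X := by
      refine exists_mem_notMem_of_card_lt_card ?_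
      have h1 : (#(I.biUnion X) : ℝ) ≤ #I * μ := by
        calc (#(I.biUnion X) : ℝ) ≤ ((∑ j ∈ I, #(X j) : ℕ) : ℝ) := by
              exact_mod_cast card_biUnion_le
          _ ≤ ∑ j ∈ I, μ := by
              push_cast
              exact sum_le_sum hX
          _ = _ := by simp
      have h2 : (#I : ℝ) < 16 ^ (#I + 1) := by
        exact_mod_cast (Nat.lt_pow_self (by norm_num : 1 < 16)).trans
          (Nat.pow_lt_pow_right (by norm_num : 1 < 16) (Nat.lt_succ_self _))
      have h3 := hcard i (mem_insert_self i I)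
      have h4 := mul_lt_mul_of_pos_right h2 hμ
      exact_mod_cast (h1.trans_lt h4).trans_le h3
    obtain ⟨f, hf1, hf2⟩ := ih (fun j => N j v)
      (fun j hj w hw => hA j (mem_insert_of_mem hj) w (mem_filter.1 hw).1) (by
        intro j hj
        have h1 : v ∉ X j := fun h => hvX (mem_biUnion.2 ⟨j, hj, h⟩)
        have h2 : (#(A j) : ℝ) < 16 * #(N j v) := by
          by_contra! h
          exact h1 (mem_filter.2 ⟨hv, h⟩)
        have h3 := hcard j (mem_insert_of_mem hj)
        rw [pow_succ] at h3
        linarith)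
    have hne : ∀ j ∈ I, j ≠ i := fun j hj e => hi (e ▸ hj)
    have hadj : ∀ j ∈ I, (C.labelGraph (χ i j)).Adj v (f j) := fun j hj =>
      (mem_filter.1 (hf1 j hj)).2
    refine ⟨Function.update f i v, ?_, ?_⟩
    · intro j hj
      rcases mem_insert.1 hj with rfl | hj
      · simpa using hv
      · rw [update_of_ne (hne j hj)]
        exact (mem_filter.1 (hf1 j hj)).1
    · intro j hj l hl hjl
      rcases mem_insert.1 hj with rfl | hj <;> rcases mem_insert.1 hl with hl | hl
      · exact absurd hl.symm hjl
      · rw [update_self, update_of_ne (hne l hl)]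
        exact hadj l hl
      · rw [hl, update_self, update_of_ne (hne j hj), hχ]
        exact (hadj j hj).symm
      · rw [update_of_ne (hne j hj), update_of_ne (hne l hl)]
        exact hf2 j hj l hl hjl

/-! ### Most colourings are generic -/

/-- The colourings in which a fixed colour has density at most `1 / 16` between two fixed disjoint
vertex sets, half of whose pairs are edges, form an exponentially small proportion. -/
theorem card_sparse_colour_le {V : Type*} [Fintype V] (G : SimpleGraph V) {X Y : Finset V}
    (hXY : Disjoint X Y) (hd : (#X * #Y : ℝ) ≤ 2 * #(G.interedges X Y)) (c : Fin 3) :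
    (#{C : G.EdgeLabeling (Fin 3) |
        16 * (#((C.labelGraph c).interedges X Y) : ℝ) ≤ #X * #Y} : ℝ) ≤
      3 ^ #G.edgeFinset * 2 ^ (-((#X * #Y : ℝ) / 16)) := by
  set N : ℝ := #X * #Y with hN
  let F : Finset G.edgeSet := {e | ∃ x ∈ X, ∃ y ∈ Y, e.1 = s(x, y)}
  have hF : ∀ Q : G.edgeSet → Prop, #{e ∈ F | Q e} =
      #{z ∈ X ×ˢ Y | ∃ h : s(z.1, z.2) ∈ G.edgeSet, Q ⟨s(z.1, z.2), h⟩} := by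
    intro Q
    symm
    refine card_bij (fun z hz => ⟨s(z.1, z.2), (mem_filter.1 hz).2.choose⟩) ?_ ?_ ?_
    · intro z hz
      have hz' := mem_filter.1 hz
      have hm := mem_product.1 hz'.1
      exact mem_filter.2 ⟨mem_filter.2 ⟨mem_univ _, z.1, hm.1, z.2, hm.2, rfl⟩,
        hz'.2.choose_spec⟩
    · intro z hz w hw h
      have hz' := mem_product.1 (mem_filter.1 hz).1
      have hw' := mem_product.1 (mem_filter.1 hw).1
      have h' : s(z.1, z.2) = s(w.1, w.2) := congrArg Subtype.val h
      rcases Sym2.eq_iff.1 h' with ⟨h1, h2⟩ | ⟨h1, h2⟩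
      · exact Prod.ext h1 h2
      · exact absurd (h1 ▸ hw'.2) (Finset.disjoint_left.1 hXY hz'.1)
    · rintro ⟨e, he⟩ hmem
      obtain ⟨h1, h2⟩ := mem_filter.1 hmem
      obtain ⟨x, hx, y, hy, rfl⟩ := (mem_filter.1 h1).2
      exact ⟨(x, y), mem_filter.2 ⟨mem_product.2 ⟨hx, hy⟩, he, h2⟩, rfl⟩
  have hF1 : #F = #(G.interedges X Y) := by
    have := hF (fun _ => True)
    simpa [SimpleGraph.interedges, Rel.interedges] using this
  have hF2 : ∀ C : G.EdgeLabeling (Fin 3),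
      #{e ∈ F | C e = c} = #((C.labelGraph c).interedges X Y) := by
    intro C
    rw [hF, SimpleGraph.interedges, Rel.interedges]
    congr 1
    ext z
    simp only [mem_filter, SimpleGraph.EdgeLabeling.labelGraph_adj]
    rfl
  let 𝓕 : Finset (G.EdgeLabeling (Fin 3)) :=
    {C | 16 * (#((C.labelGraph c).interedges X Y) : ℝ) ≤ N}
  let R : G.edgeSet → Finset (Fin 3) := fun e => if e ∈ F then {c} else ∅
  have h𝓕 : ∀ C ∈ 𝓕, (∀ e, C e ∈ (univ : Finset (Fin 3))) ∧
      (#{e | C e ∈ R e} : ℝ) ≤ N / 16 := by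
    intro C hC
    refine ⟨fun _ => mem_univ _, ?_⟩
    have h1 := (mem_filter.1 hC).2
    have h2 : #{e | C e ∈ R e} = #((C.labelGraph c).interedges X Y) := by
      rw [← hF2]
      congr 1
      ext e
      by_cases he : e ∈ F <;> simp [R, he]
    rw [h2]
    linarith
  have key := card_rare_le (fun _ : G.edgeSet => (univ : Finset (Fin 3))) R
    (q := 1 / 2) (s := N / 16) (by norm_num) (by norm_num) 𝓕
    (fun f hf => by convert! h𝓕 f hf)
  refine key.trans ?_
  have hprod : ∀ e : G.edgeSet,
      (#(univ \ R e) : ℝ) + 1 / 2 * #(univ ∩ R e) = 3 * (if e ∈ F then 5 / 6 else 1) := by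
    intro e
    by_cases he : e ∈ F
    · simp only [R, he, if_true, univ_inter, card_singleton]
      rw [← compl_eq_univ_sdiff, card_compl]
      norm_num
    · simp [R, he]
  rw [prod_congr rfl fun e _ => hprod e, prod_mul_distrib, prod_const, prod_ite, prod_const,
    prod_const_one, mul_one, filter_mem_eq_inter, univ_inter, card_univ,
    ← SimpleGraph.edgeFinset_card, hF1]
  have hN0 : 0 ≤ N := by positivity
  -- The weight `1 / 2` for the colour `c` leaves `5 / 2` out of `3` for each of the at least `N / 2`
  -- edges, and `2 * (5 / 6) ^ 8 ≤ 1 / 2`.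
  have h1 : (5 / 6 : ℝ) ^ #(G.interedges X Y) ≤ ((5 / 6 : ℝ) ^ (8 : ℝ)) ^ (N / 16) := by
    rw [← Real.rpow_mul (by norm_num), ← Real.rpow_natCast]
    exact Real.rpow_le_rpow_of_exponent_ge (by norm_num) (by norm_num) (by linarith)
  have h2 : ((5 / 6 : ℝ) ^ (8 : ℝ)) ^ (N / 16) ≤ (1 / 4 : ℝ) ^ (N / 16) := by
    refine Real.rpow_le_rpow (by positivity) ?_ (by positivity)
    norm_num
  have h3 : (1 / 2 : ℝ) ^ (-(N / 16)) * (1 / 4 : ℝ) ^ (N / 16) = 2 ^ (-(N / 16)) := by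
    rw [show (1 / 4 : ℝ) = 1 / 2 * (1 / 2) by norm_num, Real.mul_rpow (by norm_num) (by norm_num),
      ← mul_assoc, ← Real.rpow_add (by norm_num), neg_add_cancel, Real.rpow_zero, one_mul,
      one_div, Real.inv_rpow (by norm_num), Real.rpow_neg (by norm_num)]
  calc _ = 3 ^ #G.edgeFinset * ((1 / 2 : ℝ) ^ (-(N / 16)) * (5 / 6) ^ #(G.interedges X Y)) := by
        convert! (mul_left_comm _ _ _) using 3
    _ ≤ 3 ^ #G.edgeFinset * ((1 / 2 : ℝ) ^ (-(N / 16)) * (1 / 4 : ℝ) ^ (N / 16)) := by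
        gcongr
        exact h1.trans h2
    _ = _ := by rw [h3]

/-- Non-generic colourings are few: a union bound over the two sets and the colour that witness the
failure of genericity. -/
theorem card_not_isGeneric_le {V ι : Type*} [Fintype V] (G : SimpleGraph V) (p : V → ι) {μ : ℝ}
    (hμ : 0 < μ)
    (hd : ∀ X Y : Finset V, (∀ x ∈ X, ∀ y ∈ Y, p x ≠ p y) → μ ≤ #X → μ ≤ #Y →
      (#X * #Y : ℝ) ≤ 2 * #(G.interedges X Y)) :
    (#{C : G.EdgeLabeling (Fin 3) | ¬ IsGeneric p μ C} : ℝ) ≤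
      3 * 4 ^ Fintype.card V * (3 ^ #G.edgeFinset * 2 ^ (-(μ ^ 2 / 16))) := by
  let Z : Finset ((Finset V × Finset V) × Fin 3) :=
    {z | (∀ x ∈ z.1.1, ∀ y ∈ z.1.2, p x ≠ p y) ∧ μ ≤ #z.1.1 ∧ μ ≤ #z.1.2}
  let B : (Finset V × Finset V) × Fin 3 → Finset (G.EdgeLabeling (Fin 3)) := fun z =>
    {C | 16 * (#((C.labelGraph z.2).interedges z.1.1 z.1.2) : ℝ) ≤ #z.1.1 * #z.1.2}
  have hsub : ({C | ¬ IsGeneric p μ C} : Finset (G.EdgeLabeling (Fin 3))) ⊆ Z.biUnion B := by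
    intro C hC
    have hC' := (mem_filter.1 hC).2
    simp only [IsGeneric, not_forall, not_lt] at hC'
    obtain ⟨X, Y, i, j, hij, hX, hY, h1, h2, c, h⟩ := hC'
    refine mem_biUnion.2 ⟨((X, Y), c), mem_filter.2 ⟨mem_univ _, fun x hx y hy => ?_, h1, h2⟩,
      mem_filter.2 ⟨mem_univ _, h⟩⟩
    rw [hX x hx, hY y hy]
    exact hij
  have hB : ∀ z ∈ Z, (#(B z) : ℝ) ≤ 3 ^ #G.edgeFinset * 2 ^ (-(μ ^ 2 / 16)) := by
    intro z hz
    obtain ⟨h1, h2, h3⟩ := (mem_filter.1 hz).2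
    have hdis : Disjoint z.1.1 z.1.2 := Finset.disjoint_left.2 fun x hx hy => h1 x hx x hy rfl
    refine (card_sparse_colour_le G hdis (hd _ _ h1 h2 h3) z.2).trans ?_
    gcongr
    · norm_num
    · nlinarith
  calc (#{C : G.EdgeLabeling (Fin 3) | ¬ IsGeneric p μ C} : ℝ)
      ≤ ((∑ z ∈ Z, #(B z) : ℕ) : ℝ) := by exact_mod_cast (card_le_card hsub).trans card_biUnion_le
    _ ≤ ∑ z ∈ Z, 3 ^ #G.edgeFinset * 2 ^ (-(μ ^ 2 / 16)) := by
        push_cast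
        exact sum_le_sum hB
    _ = #Z * (3 ^ #G.edgeFinset * 2 ^ (-(μ ^ 2 / 16))) := by rw [sum_const, nsmul_eq_mul]
    _ ≤ _ := by
        gcongr
        have : #Z ≤ Fintype.card ((Finset V × Finset V) × Fin 3) := card_le_univ _
        rw [Fintype.card_prod, Fintype.card_prod, Fintype.card_finset, Fintype.card_fin,
          ← mul_pow] at this
        calc (#Z : ℝ) ≤ ((2 * 2) ^ Fintype.card V * 3 : ℕ) := by exact_mod_cast this
          _ = _ := by push_cast; ring

/-! ### Turán numbers -/

theorem two_mul_extremalNumber_le (n : ℕ) {r : ℕ} (hr : 1 ≤ r) :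
    2 * r * (SimpleGraph.extremalNumber n (⊤ : SimpleGraph (Fin (r + 1))) : ℝ) ≤
      (r - 1) * (n : ℝ) ^ 2 := by
  have : Nontrivial (Fin (r + 1)) := Fin.nontrivial_iff_two_le.2 (by omega)
  have h := SimpleGraph.mul_card_edgeFinset_turanGraph_le (n := n) (r := r)
  rw [SimpleGraph.extremalNumber_top, Fintype.card_fin, Nat.add_sub_cancel]
  rw [← Nat.cast_pred hr]
  exact_mod_cast h

theorem le_two_mul_extremalNumber (n : ℕ) {r : ℕ} (hr : 1 ≤ r) :
    (r - 1) * (n : ℝ) ^ 2 - (r ^ 3 + 2 * r) ≤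
      2 * r * (SimpleGraph.extremalNumber n (⊤ : SimpleGraph (Fin (r + 1))) : ℝ) := by
  have : Nontrivial (Fin (r + 1)) := Fin.nontrivial_iff_two_le.2 (by omega)
  rw [SimpleGraph.extremalNumber_top, Fintype.card_fin, Nat.add_sub_cancel,
    SimpleGraph.card_edgeFinset_turanGraph]
  set m := n % r with hm
  have hmr : m < r := Nat.mod_lt _ hr
  have hmn : m ≤ n := Nat.mod_le _ _
  have h1 : (n ^ 2 - m ^ 2) * (r - 1) <
      2 * r * ((n ^ 2 - m ^ 2) * (r - 1) / (2 * r)) + 2 * r := by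
    have h2 := Nat.div_add_mod ((n ^ 2 - m ^ 2) * (r - 1)) (2 * r)
    have h3 := Nat.mod_lt ((n ^ 2 - m ^ 2) * (r - 1)) (show 2 * r > 0 by omega)
    omega
  have h2 : (((n ^ 2 - m ^ 2 : ℕ) : ℝ)) * ((r - 1 : ℕ) : ℝ) ≤
      2 * r * (((n ^ 2 - m ^ 2) * (r - 1) / (2 * r) : ℕ) : ℝ) + 2 * r := by exact_mod_cast h1.le
  rw [Nat.cast_sub (Nat.pow_le_pow_left hmn 2), Nat.cast_sub hr] at h2
  push_cast at h2 ⊢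
  have h3 : (m : ℝ) ≤ r := by exact_mod_cast hmr.le
  have h4 : (1 : ℝ) ≤ r := by exact_mod_cast hr
  have h5 : ((r : ℝ) - 1) * m ^ 2 ≤ r * r ^ 2 := by gcongr; linarith
  have h6 : (0 : ℝ) ≤ 2 * r * (m.choose 2 : ℝ) := by positivity
  nlinarith

/-! ### Vertex partitions -/

/-- The edges of `G` inside the classes of the vertex partition `p`. -/
def innerGraph {V ι : Type*} (G : SimpleGraph V) (p : V → ι) : SimpleGraph V where
  Adj u v := G.Adj u v ∧ p u = p v
  symm := ⟨fun _ _ h => ⟨h.1.symm, h.2.symm⟩⟩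
  loopless := ⟨fun _ h => h.1.ne rfl⟩

@[simp]
theorem innerGraph_adj {V ι : Type*} {G : SimpleGraph V} {p : V → ι} {u v : V} :
    (innerGraph G p).Adj u v ↔ G.Adj u v ∧ p u = p v := Iff.rfl

theorem card_edgeFinset_innerGraph_le {V ι : Type*} [Fintype V] [Fintype ι] (G : SimpleGraph V)
    (p : V → ι) :
    #(innerGraph G p).edgeFinset ≤ ∑ i, (G.induce {v | p v = i}).edgeSet.ncard := by
  have hsub : (innerGraph G p).edgeSet ⊆
      ⋃ i, (Sym2.map Subtype.val) '' (G.induce {v | p v = i}).edgeSet := by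
    intro e he
    induction e using Sym2.inductionOn with
    | _ u v =>
      exact Set.mem_iUnion.2 ⟨p v, s(⟨u, he.2⟩, ⟨v, rfl⟩), he.1, rfl⟩
  rw [← Set.ncard_coe_finset, SimpleGraph.coe_edgeFinset]
  refine (Set.ncard_le_ncard hsub (Set.toFinite _)).trans ?_
  refine (Set.ncard_iUnion_le_of_fintype _).trans (sum_le_sum fun i _ => ?_)
  exact Set.ncard_image_le (Set.toFinite _)

/-- In a partition with fewest inner edges no vertex has more neighbours in its own class than in
another one. -/
theorem card_neighbours_le_of_forall_innerGraph_le {V ι : Type*} [Fintype V] {G : SimpleGraph V}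
    {p : V → ι}
    (hp : ∀ p' : V → ι, #(innerGraph G p).edgeFinset ≤ #(innerGraph G p').edgeFinset)
    (x : V) (j : ι) : #{v | G.Adj x v ∧ p v = p x} ≤ #{v | G.Adj x v ∧ p v = j} := by
  have hdeg : ∀ p' : V → ι, (innerGraph G p').degree x = #{v | G.Adj x v ∧ p' v = p' x} := by
    intro p'
    rw [← SimpleGraph.card_neighborFinset_eq_degree, SimpleGraph.neighborFinset_eq_filter]
    congr 1
    ext v
    simp only [mem_filter, mem_univ, true_and, innerGraph_adj, eq_comm]
  -- Moving `x` to the class `j` changes only the inner edges at `x`.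
  let p' := update p x j
  have hdel : (innerGraph G p).deleteIncidenceSet x = (innerGraph G p').deleteIncidenceSet x := by
    ext u v
    simp only [SimpleGraph.deleteIncidenceSet_adj, innerGraph_adj, p']
    constructor
    · rintro ⟨h, hu, hv⟩
      simpa [hu, hv] using h
    · rintro ⟨h, hu, hv⟩
      simpa [hu, hv] using h
  have h1 := (innerGraph G p).card_edgeFinset_deleteIncidenceSet x
  have h2 := (innerGraph G p').card_edgeFinset_deleteIncidenceSet x
  have h3 : #((innerGraph G p).deleteIncidenceSet x).edgeFinset =
      #((innerGraph G p').deleteIncidenceSet x).edgeFinset := by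
    congr! 2
  have h4 := (innerGraph G p).degree_le_card_edgeFinset x
  have h5 := (innerGraph G p').degree_le_card_edgeFinset x
  have h6 : #{v | G.Adj x v ∧ p' v = p' x} = #{v | G.Adj x v ∧ p v = j} := by
    congr 1
    ext v
    simp only [mem_filter, mem_univ, true_and, p', update_self]
    refine and_congr_right fun h => ?_
    rw [update_of_ne h.ne']
  have h7 := hp p'
  rw [hdeg] at h1 h2 h4 h5
  omega

theorem card_interedges_le_card_edgeFinset {V : Type*} (G : SimpleGraph V)
    [DecidableRel G.Adj] [Fintype G.edgeSet] {X Y : Finset V} (hXY : Disjoint X Y) :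
    #(G.interedges X Y) ≤ #G.edgeFinset := by
  refine card_le_card_of_injOn (fun z => s(z.1, z.2)) ?_ ?_
  · intro z hz
    have := (SimpleGraph.mem_interedges_iff _).1 hz
    exact SimpleGraph.mem_edgeFinset.2 this.2.2
  · intro z hz w hw h
    have hz' := (SimpleGraph.mem_interedges_iff _).1 hz
    have hw' := (SimpleGraph.mem_interedges_iff _).1 hw
    rcases Sym2.eq_iff.1 h with ⟨h1, h2⟩ | ⟨h1, h2⟩
    · exact Prod.ext h1 h2
    · exact absurd (h1 ▸ hw'.2.1) (Finset.disjoint_left.1 hXY hz'.1)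

theorem free_of_hom {V : Type*} {r : ℕ} {G : SimpleGraph V} {p : V → Fin r}
    (hp : ∀ u v, G.Adj u v → p u ≠ p v) :
    (⊤ : SimpleGraph (Fin (r + 1))).Free G := by
  rintro ⟨f⟩
  have hinj : Injective fun a => p (f a) := by
    intro a b h
    by_contra hab
    exact hp _ _ (f.toHom.map_adj (show (⊤ : SimpleGraph _).Adj a b from hab)) h
  have := Fintype.card_le_of_injective _ hinj
  simp at this

section Multipartite

variable {V : Type*} [Fintype V] {r : ℕ} (G : SimpleGraph V) (p : V → Fin r)

theorem card_edgeFinset_comap_le :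
    #((⊤ : SimpleGraph (Fin r)).comap p).edgeFinset ≤
      SimpleGraph.extremalNumber (Fintype.card V) (⊤ : SimpleGraph (Fin (r + 1))) :=
  SimpleGraph.card_edgeFinset_le_extremalNumber (free_of_hom (p := p) fun _ _ h => h)

/-- The edges of `G` and the missing edges of the complete multipartite graph on the classes of `p`
together are the edges of that multipartite graph and the inner edges of `G`. -/
theorem card_edgeFinset_add_card_sdiff :
    #G.edgeFinset + #((⊤ : SimpleGraph (Fin r)).comap p \ G).edgeFinset =
      #((⊤ : SimpleGraph (Fin r)).comap p).edgeFinset + #(innerGraph G p).edgeFinset := by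
  rw [← card_union_of_disjoint, ← card_union_of_disjoint]
  · congr 1
    ext e
    induction e using Sym2.inductionOn with
    | _ u v =>
      simp only [mem_union, SimpleGraph.mem_edgeFinset, SimpleGraph.mem_edgeSet,
        SimpleGraph.sdiff_adj, SimpleGraph.comap_adj, SimpleGraph.top_adj, innerGraph_adj]
      tauto
  · rw [Finset.disjoint_left]
    intro e
    induction e using Sym2.inductionOn with
    | _ u v =>
      simp only [SimpleGraph.mem_edgeFinset, SimpleGraph.mem_edgeSet,
        SimpleGraph.comap_adj, SimpleGraph.top_adj, innerGraph_adj]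
      tauto
  · rw [Finset.disjoint_left]
    intro e
    induction e using Sym2.inductionOn with
    | _ u v =>
      simp only [SimpleGraph.mem_edgeFinset, SimpleGraph.mem_edgeSet, SimpleGraph.sdiff_adj]
      tauto

/-- A graph with at least as many edges as the Turán graph misses few edges between the classes
of a partition with few inner edges. -/
theorem card_mul_card_le_interedges_add
    (hG : SimpleGraph.extremalNumber (Fintype.card V) (⊤ : SimpleGraph (Fin (r + 1))) ≤
      #G.edgeFinset) {X Y : Finset V} (hXY : ∀ x ∈ X, ∀ y ∈ Y, p x ≠ p y) :
    #X * #Y ≤ #(G.interedges X Y) + #(innerGraph G p).edgeFinset := by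
  have hdis : Disjoint X Y := Finset.disjoint_left.2 fun x hx hy => hXY x hx x hy rfl
  have h1 := card_edgeFinset_add_card_sdiff G p
  have h2 := card_edgeFinset_comap_le p
  have h3 := card_interedges_le_card_edgeFinset ((⊤ : SimpleGraph (Fin r)).comap p \ G) hdis
  have h4 : #X * #Y ≤
      #(G.interedges X Y) + #(((⊤ : SimpleGraph (Fin r)).comap p \ G).interedges X Y) := by
    rw [← card_product]
    refine le_trans (card_le_card ?_) (card_union_le _ _)
    intro z hz
    obtain ⟨hx, hy⟩ := mem_product.1 hz
    rw [mem_union, SimpleGraph.mem_interedges_iff, SimpleGraph.mem_interedges_iff]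
    by_cases h : G.Adj z.1 z.2
    · exact Or.inl ⟨hx, hy, h⟩
    · exact Or.inr ⟨hx, hy, hXY _ hx _ hy, h⟩
  omega

theorem card_edgeFinset_le_extremalNumber_add_inner :
    #G.edgeFinset ≤ SimpleGraph.extremalNumber (Fintype.card V)
      (⊤ : SimpleGraph (Fin (r + 1))) + #(innerGraph G p).edgeFinset := by
  have h1 := card_edgeFinset_add_card_sdiff G p
  have h2 := card_edgeFinset_comap_le p
  omega

theorem two_mul_card_edgeFinset_comap :
    2 * #((⊤ : SimpleGraph (Fin r)).comap p).edgeFinset + ∑ i, #{v | p v = i} ^ 2 =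
      Fintype.card V ^ 2 := by
  rw [← SimpleGraph.sum_degrees_eq_twice_card_edges]
  have h1 : ∑ i, #{v | p v = i} ^ 2 = ∑ v, #{u | p u = p v} := by
    rw [← sum_fiberwise (s := univ) (g := p)]
    refine sum_congr rfl fun i _ => ?_
    rw [sum_congr rfl (g := fun _ => #{u | p u = i}) fun v hv => by rw [(mem_filter.1 hv).2]]
    rw [sum_const, sq, smul_eq_mul]
  rw [h1, ← sum_add_distrib, sq, ← smul_eq_mul, ← card_univ (α := V), ← sum_const]
  refine sum_congr rfl fun v _ => ?_
  rw [← SimpleGraph.card_neighborFinset_eq_degree, SimpleGraph.neighborFinset_eq_filter,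
    ← card_filter_add_card_filter_not (s := univ) (fun u => p v ≠ p u)]
  congr 2
  ext u
  simp [eq_comm]

/-- The classes of a partition with few inner edges are nearly equal in size. -/
theorem sq_card_class_sub_le (hr : 1 ≤ r)
    (hG : SimpleGraph.extremalNumber (Fintype.card V) (⊤ : SimpleGraph (Fin (r + 1))) ≤
      #G.edgeFinset) (i : Fin r) :
    ((#{v | p v = i} : ℝ) - Fintype.card V / r) ^ 2 ≤
      r ^ 2 + 2 + 2 * #(innerGraph G p).edgeFinset := by
  have hr' : (1 : ℝ) ≤ r := by exact_mod_cast hr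
  set n : ℝ := (Fintype.card V : ℝ) with hn
  set t := SimpleGraph.extremalNumber (Fintype.card V) (⊤ : SimpleGraph (Fin (r + 1))) with ht
  have h1 := two_mul_card_edgeFinset_comap p
  have h2 := card_edgeFinset_add_card_sdiff G p
  have h3 : (t : ℝ) ≤ #((⊤ : SimpleGraph (Fin r)).comap p).edgeFinset +
      #(innerGraph G p).edgeFinset := by
    have : t ≤ #((⊤ : SimpleGraph (Fin r)).comap p).edgeFinset +
      #(innerGraph G p).edgeFinset := by omega
    exact_mod_cast this
  have h4 : 2 * (#((⊤ : SimpleGraph (Fin r)).comap p).edgeFinset : ℝ) +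
      ∑ i, (#{v | p v = i} : ℝ) ^ 2 = n ^ 2 := by
    rw [hn]
    exact_mod_cast h1
  have h5 : ∑ i, (#{v | p v = i} : ℝ) = n := by
    have := card_eq_sum_card_fiberwise (s := univ) (t := univ) (f := p)
      fun _ _ => mem_coe.2 (mem_univ _)
    rw [hn, ← card_univ, this]
    push_cast
    rfl
  -- The Turán graph has `(1 - 1 / r) n ^ 2 / 2 - O(1)` edges, so the variance of the class sizes is
  -- at most `2 * #(inner edges) + O(1)`.
  have h6 : ∑ i, ((#{v | p v = i} : ℝ) - n / r) ^ 2 =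
      ∑ i, (#{v | p v = i} : ℝ) ^ 2 - n ^ 2 / r := by
    simp_rw [sub_sq]
    rw [sum_add_distrib, sum_sub_distrib, ← sum_mul, ← mul_sum, h5]
    simp
    field_simp
    ring
  have h7 := le_two_mul_extremalNumber (Fintype.card V) hr
  rw [← ht, ← hn] at h7
  have h8 : n ^ 2 - n ^ 2 / r - (r ^ 2 + 2) ≤ 2 * t := by
    have : (r : ℝ) * (n ^ 2 - n ^ 2 / r - (r ^ 2 + 2)) ≤ r * (2 * t) := by
      calc (r : ℝ) * (n ^ 2 - n ^ 2 / r - (r ^ 2 + 2)) =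
          (r - 1) * n ^ 2 - (r ^ 3 + 2 * r) := by field_simp
        _ ≤ _ := by linarith
    exact le_of_mul_le_mul_left this (by linarith)
  have h9 : ((#{v | p v = i} : ℝ) - n / r) ^ 2 ≤ ∑ i, ((#{v | p v = i} : ℝ) - n / r) ^ 2 :=
    single_le_sum (f := fun i => ((#{v | p v = i} : ℝ) - n / r) ^ 2)
      (fun i _ => sq_nonneg _) (mem_univ i)
  linarith

end Multipartite

/-! ### Finding a pattern in a generic colouring -/

/-- The colour that the naming `τ` of the classes of a pattern gives to the pair `a`, `b`, with a
junk value for `a = b`. -/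
noncomputable def patternColour {k : ℕ} {P : EdgePattern (⊤ : SimpleGraph (Fin k))}
    (τ : Quotient P → Fin 3) (a b : Fin k) : Fin 3 :=
  if h : a ≠ b then τ (Quotient.mk P ⟨s(a, b), h⟩) else 0

theorem patternColour_of_ne {k : ℕ} {P : EdgePattern (⊤ : SimpleGraph (Fin k))}
    (τ : Quotient P → Fin 3) {a b : Fin k} (h : a ≠ b) :
    patternColour τ a b = τ (Quotient.mk P ⟨s(a, b), h⟩) := dif_pos h

theorem patternColour_comm {k : ℕ} {P : EdgePattern (⊤ : SimpleGraph (Fin k))}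
    (τ : Quotient P → Fin 3) (a b : Fin k) : patternColour τ a b = patternColour τ b a := by
  by_cases h : a = b
  · rw [h]
  · rw [patternColour_of_ne τ h, patternColour_of_ne τ (Ne.symm h)]
    congr 3
    exact Sym2.eq_swap

/-- The vertex `x` followed by `f` carries the pattern, split into the colours from `x` and the
colours between the values of `f`. -/
theorem containsPattern_cons {V : Type*} {r : ℕ} {G : SimpleGraph V}
    {P : EdgePattern (⊤ : SimpleGraph (Fin (r + 1)))} {C : G.EdgeLabeling (Fin 3)}
    {τ : Quotient P → Fin 3} (hτ : Injective τ) (x : V) (f : Fin r → V)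
    (hx : ∀ i, (C.labelGraph (patternColour τ 0 i.succ)).Adj x (f i))
    (hf : ∀ i j, i ≠ j → (C.labelGraph (patternColour τ i.succ j.succ)).Adj (f i) (f j)) :
    ContainsPattern P C := by
  refine containsPattern_of_labelGraph_adj hτ (Fin.cons x f) fun a b h => ?_
  rw [← patternColour_of_ne τ h]
  cases a using Fin.cases with
  | zero =>
    cases b using Fin.cases with
    | zero => exact absurd rfl h
    | succ j => simpa using hx j
  | succ i =>
    cases b using Fin.cases with
    | zero =>
      rw [patternColour_comm]
      simpa using (hx i).symm
    | succ j => simpa using hf i j fun e => h (e ▸ rfl)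

theorem exists_perm_fin_three : ∀ a a' b b' : Fin 3, (a = a' ↔ b = b') →
    ∃ π : Equiv.Perm (Fin 3), π a = b ∧ π a' = b' := by
  decide

theorem exists_injective_classes {k : ℕ} {P : EdgePattern (⊤ : SimpleGraph (Fin k))}
    (hP : P.numClasses ≤ 3) {q q' : Quotient P} {c c' : Fin 3} (h : q = q' ↔ c = c') :
    ∃ τ : Quotient P → Fin 3, Injective τ ∧ τ q = c ∧ τ q' = c' := by
  have hcard : Fintype.card (Quotient P) ≤ Fintype.card (Fin 3) := by
    rw [Fintype.card_fin, ← Nat.card_eq_fintype_card]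
    exact hP
  obtain ⟨τ⟩ := Function.Embedding.nonempty_of_card_le hcard
  obtain ⟨π, h1, h2⟩ := exists_perm_fin_three (τ q) (τ q') c c' (τ.injective.eq_iff.trans h)
  exact ⟨π ∘ τ, π.injective.comp τ.injective, h1, h2⟩

theorem exists_mem_of_three_le : ∀ S T : Finset (Fin 3), 3 ≤ #S * #T →
    (∃ a ∈ S, a ∈ T) ∧ ∃ a ∈ S, ∃ b ∈ T, a ≠ b := by
  decide

/-- If lists of colours `S i` at the `r` edges of a star have product of sizes at least
`3 ^ (r - 1)`, then at most two lists are not full, and the classes of any pattern can be named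
so that the star is coloured from the lists. -/
theorem exists_injective_classes_star {r : ℕ} (hr : 2 ≤ r)
    {P : EdgePattern (⊤ : SimpleGraph (Fin (r + 1)))} (hP : P.numClasses ≤ 3)
    (S : Fin r → Finset (Fin 3)) (hS : 3 ^ (r - 1) ≤ ∏ i, #(S i)) :
    ∃ τ : Quotient P → Fin 3, Injective τ ∧ ∀ i, patternColour τ 0 i.succ ∈ S i := by
  let D : Finset (Fin r) := {i | S i ≠ univ}
  have hle : ∀ i, #(S i) ≤ 3 := fun i => (card_le_univ _).trans (by simp)
  have hD : ∀ i ∈ D, #(S i) ≤ 2 := by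
    intro i hi
    have := card_lt_univ_of_notMem (s := S i)
      (Classical.not_forall.1 fun h => (mem_filter.1 hi).2 (eq_univ_iff_forall.2 h)).choose_spec
    rw [Fintype.card_fin] at this
    omega
  have hDr : #D ≤ r := (card_le_univ _).trans (by simp)
  -- Three lists that are not full would give a product of at most `8 / 9 * 3 ^ (r - 1)`.
  have hD2 : #D ≤ 2 := by
    by_contra! h
    obtain ⟨e, he⟩ := Nat.exists_eq_add_of_le h
    obtain ⟨g, hg⟩ := Nat.exists_eq_add_of_le hDr
    have h1 : ∏ i, #(S i) ≤ 2 ^ #D * 3 ^ g := by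
      rw [← prod_mul_prod_compl D]
      refine Nat.mul_le_mul (prod_le_pow_card _ _ _ hD) ?_
      have := prod_le_pow_card Dᶜ (fun i => #(S i)) 3 fun i _ => hle i
      rwa [card_compl, Fintype.card_fin, show r - #D = g by omega] at this
    have h2 : 3 ^ (r - 1) = 9 * 3 ^ e * 3 ^ g := by
      rw [show r - 1 = 2 + e + g by omega, pow_add, pow_add]
      norm_num
    have h3 : 2 ^ #D = 8 * 2 ^ e := by
      rw [he, pow_add]
      norm_num
    have h4 : 2 ^ e ≤ 3 ^ e := Nat.pow_le_pow_left (by norm_num) e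
    have h5 : 0 < 3 ^ e := by positivity
    have h6 : 0 < 3 ^ g := by positivity
    have h7 := hS.trans h1
    rw [h2, h3] at h7
    have := Nat.le_of_mul_le_mul_right h7 h6
    omega
  obtain ⟨T, hDT, -, hT⟩ := exists_subsuperset_card_eq (subset_univ D) hD2 (by simpa using hr)
  obtain ⟨i, j, hij, rfl⟩ := card_eq_two.1 hT
  have hfull : ∀ l, l ≠ i → l ≠ j → S l = univ := by
    intro l hi hj
    by_contra h
    have := hDT (mem_filter.2 ⟨mem_univ l, h⟩)
    simp [hi, hj] at this
  have h3 : 3 ≤ #(S i) * #(S j) := by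
    have h1 : ∏ l, #(S l) = #(S i) * #(S j) * 3 ^ (r - 2) := by
      rw [← prod_mul_prod_compl {i, j}, prod_pair hij]
      congr 1
      rw [prod_congr rfl (g := fun _ => 3), prod_const, card_compl, card_pair hij,
        Fintype.card_fin]
      intro l hl
      simp only [mem_compl, mem_insert, mem_singleton, not_or] at hl
      rw [hfull l hl.1 hl.2]
      simp
    rw [h1, show r - 1 = (r - 2) + 1 by omega, pow_succ, mul_comm] at hS
    exact Nat.le_of_mul_le_mul_right hS (by positivity)
  have hne : ∀ l : Fin r, (0 : Fin (r + 1)) ≠ l.succ := fun l => (Fin.succ_ne_zero l).symm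
  let q : Fin r → Quotient P := fun l => ⟦⟨s(0, l.succ), hne l⟩⟧
  -- The two remaining edges lie in the same class or in different classes, which asks for equal or
  -- for different colours; the product `#(S i) * #(S j) ≥ 3` permits both.
  obtain ⟨⟨a, ha, ha'⟩, b, hb, b', hb', hbb⟩ := exists_mem_of_three_le _ _ h3
  obtain ⟨τ, hτ, hi, hj⟩ : ∃ τ : Quotient P → Fin 3, Injective τ ∧ τ (q i) ∈ S i ∧
      τ (q j) ∈ S j := by
    by_cases h : q i = q j
    · obtain ⟨τ, hτ, h1, h2⟩ := exists_injective_classes hP (q := q i) (q' := q j) (c := a)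
        (c' := a) (by simp [h])
      exact ⟨τ, hτ, h1 ▸ ha, h2 ▸ ha'⟩
    · obtain ⟨τ, hτ, h1, h2⟩ := exists_injective_classes hP (q := q i) (q' := q j) (c := b)
        (c' := b') (by simp [h, hbb])
      exact ⟨τ, hτ, h1 ▸ hb, h2 ▸ hb'⟩
  refine ⟨τ, hτ, fun l => ?_⟩
  rw [patternColour_of_ne τ (hne l)]
  by_cases h1 : l = i
  · rw [h1]; exact hi
  by_cases h2 : l = j
  · rw [h2]; exact hj
  rw [hfull l h1 h2]
  exact mem_univ _

/-- A generic colouring contains the pattern if the lists of frequent colours from a vertex to the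
classes are large. -/
theorem IsGeneric.containsPattern_of_star {V : Type*} [Fintype V] {r : ℕ} (hr : 2 ≤ r)
    {G : SimpleGraph V} {P : EdgePattern (⊤ : SimpleGraph (Fin (r + 1)))} (hP : P.numClasses ≤ 3)
    {p : V → Fin r} {μ : ℝ} {C : G.EdgeLabeling (Fin 3)} (hC : IsGeneric p μ C) (hμ : 0 < μ)
    (x : V) (S : Fin r → Finset (Fin 3))
    (hS : ∀ i, ∀ c ∈ S i, 16 ^ r * μ ≤ #{v | (C.labelGraph c).Adj x v ∧ p v = i})
    (hprod : 3 ^ (r - 1) ≤ ∏ i, #(S i)) : ContainsPattern P C := by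
  obtain ⟨τ, hτ, hτS⟩ := exists_injective_classes_star hr hP S hprod
  have : Nonempty V := ⟨x⟩
  obtain ⟨f, hf1, hf2⟩ := hC.exists_transversal hμ
    (fun i j => patternColour τ i.succ j.succ) (fun i j => patternColour_comm τ _ _) univ
    (fun i => {v | (C.labelGraph (patternColour τ 0 i.succ)).Adj x v ∧ p v = i})
    (fun i _ v hv => (mem_filter.1 hv).2.2) (fun i _ => by
      rw [card_univ, Fintype.card_fin]
      exact hS i _ (hτS i))
  exact containsPattern_cons hτ x f (fun i => (mem_filter.1 (hf1 i (mem_univ i))).2.1)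
    fun i j => hf2 i (mem_univ i) j (mem_univ j)

/-- A generic colouring contains the pattern if, for an edge `xy` and a naming of the classes of the
pattern, every class other than `i₀` has many vertices seen from `x` and `y` in the colours that the
naming prescribes. Here `x` plays the role of `0` and `y` that of `i₀.succ`. -/
theorem IsGeneric.containsPattern_of_edge {V : Type*} [Fintype V] {r : ℕ}
    {G : SimpleGraph V} {P : EdgePattern (⊤ : SimpleGraph (Fin (r + 1)))}
    {p : V → Fin r} {μ : ℝ} {C : G.EdgeLabeling (Fin 3)} (hC : IsGeneric p μ C) (hμ : 0 < μ)
    {x y : V} (i₀ : Fin r) {τ : Quotient P → Fin 3} (hτ : Injective τ)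
    (hxy : (C.labelGraph (patternColour τ 0 i₀.succ)).Adj x y)
    (h : ∀ i, i ≠ i₀ → 16 ^ r * μ ≤ #{v | ((C.labelGraph (patternColour τ 0 i.succ)).Adj x v ∧
      (C.labelGraph (patternColour τ i₀.succ i.succ)).Adj y v) ∧ p v = i}) :
    ContainsPattern P C := by
  have : Nonempty V := ⟨x⟩
  obtain ⟨f, hf1, hf2⟩ := hC.exists_transversal hμ
    (fun i j => patternColour τ i.succ j.succ) (fun i j => patternColour_comm τ _ _)
    (univ.erase i₀)
    (fun i => {v | ((C.labelGraph (patternColour τ 0 i.succ)).Adj x v ∧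
      (C.labelGraph (patternColour τ i₀.succ i.succ)).Adj y v) ∧ p v = i})
    (fun i _ v hv => (mem_filter.1 hv).2.2) (fun i hi => by
      refine le_trans ?_ (h i (ne_of_mem_erase hi))
      have : #(univ.erase i₀) ≤ r := (card_le_univ _).trans (by simp)
      gcongr
      norm_num)
  have hmem : ∀ i, i ≠ i₀ → i ∈ univ.erase i₀ := fun i hi => mem_erase.2 ⟨hi, mem_univ i⟩
  refine containsPattern_cons hτ x (update f i₀ y) (fun i => ?_) fun i j hij => ?_
  · by_cases hi : i = i₀
    · rw [hi, update_self]
      exact hxy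
    · rw [update_of_ne hi]
      exact (mem_filter.1 (hf1 i (hmem i hi))).2.1.1
  · by_cases hi : i = i₀
    · have hj : j ≠ i₀ := fun e => hij (hi.trans e.symm)
      rw [hi, update_self, update_of_ne hj]
      exact (mem_filter.1 (hf1 j (hmem j hj))).2.1.2
    by_cases hj : j = i₀
    · rw [hj, update_self, update_of_ne hi, patternColour_comm]
      exact (mem_filter.1 (hf1 i (hmem i hi))).2.1.2.symm
    · rw [update_of_ne hi, update_of_ne hj]
      exact hf2 i (hmem i hi) j (hmem j hj) hij

/-! ### Counting the colourings at one vertex, or at the two ends of an edge -/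

/-- The colour of the pair `u`, `v`, with the junk value `0` for pairs that are not edges. -/
noncomputable def pairColour {V : Type*} {G : SimpleGraph V} (C : G.EdgeLabeling (Fin 3))
    (u v : V) : Fin 3 :=
  if h : G.Adj u v then C.get u v h else 0

theorem pairColour_of_adj {V : Type*} {G : SimpleGraph V} (C : G.EdgeLabeling (Fin 3)) {u v : V}
    (h : G.Adj u v) : pairColour C u v = C.get u v h := dif_pos h

theorem labelGraph_adj_iff {V : Type*} {G : SimpleGraph V} (C : G.EdgeLabeling (Fin 3)) {u v : V}
    {c : Fin 3} : (C.labelGraph c).Adj u v ↔ G.Adj u v ∧ pairColour C u v = c := by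
  rw [SimpleGraph.EdgeLabeling.labelGraph_adj]
  constructor
  · rintro ⟨h, h'⟩
    exact ⟨h, (pairColour_of_adj C h).trans h'⟩
  · rintro ⟨h, h'⟩
    exact ⟨h, (pairColour_of_adj C h).symm.trans h'⟩

theorem pairColour_mem {V : Type*} {G : SimpleGraph V} (C : G.EdgeLabeling (Fin 3)) (u v : V) :
    pairColour C u v ∈ (if G.Adj u v then univ else {0} : Finset (Fin 3)) := by
  unfold pairColour
  split_ifs <;> simp

theorem prod_comp_eq_prod_pow {V : Type*} [Fintype V] {r : ℕ} (p : V → Fin r) (g : Fin r → ℝ) :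
    ∏ v, g (p v) = ∏ i, g i ^ #{v | p v = i} := by
  rw [← prod_fiberwise (s := univ) (g := p)]
  refine prod_congr rfl fun i _ => ?_
  rw [prod_congr rfl (g := fun _ => g i) fun v hv => by rw [(mem_filter.1 hv).2], prod_const]

/-- If `x` has many neighbours in every class then, by `IsGeneric.containsPattern_of_star`, the
lists of frequent colours from `x` to the classes have product of sizes less than
`3 ^ (r - 1)`. -/
theorem card_generic_le_of_vertex {V : Type*} [Fintype V] {r : ℕ} (hr : 2 ≤ r)
    {G : SimpleGraph V} {P : EdgePattern (⊤ : SimpleGraph (Fin (r + 1)))} (hP : P.numClasses ≤ 3)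
    (p : V → Fin r) {μ q : ℝ} (hμ : 0 < μ) (hq : 0 < q) (hq1 : q ≤ 1) (x : V)
    (hx : ∀ i, 3 * (16 ^ r * μ) ≤ #{v | G.Adj x v ∧ p v = i}) {M : ℕ}
    (hM : ∀ i, #{v | p v = i} ≤ M) :
    (#{C : G.EdgeLabeling (Fin 3) | ¬ ContainsPattern P C ∧ IsGeneric p μ C} : ℝ) ≤
      patternFreeCount 3 P (G.induce {x}ᶜ) * (8 ^ r * (q ^ (-(3 * r * (16 ^ r * μ))) *
        ((1 + 3 * q) ^ Fintype.card V * (3 ^ (r - 1) - 1) ^ M))) := by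
  set α : ℝ := 16 ^ r * μ with hα
  let S : G.EdgeLabeling (Fin 3) → Fin r → Finset (Fin 3) := fun C i =>
    {c | α ≤ #{v | (C.labelGraph c).Adj x v ∧ p v = i}}
  let 𝒮 : Finset (Fin r → Finset (Fin 3)) :=
    {S | (∀ i, (S i).Nonempty) ∧ ∏ i, #(S i) < 3 ^ (r - 1)}
  let 𝓕 : (Fin r → Finset (Fin 3)) → Finset (G.EdgeLabeling (Fin 3)) := fun L =>
    {C | (¬ ContainsPattern P C ∧ IsGeneric p μ C) ∧ S C = L}
  have hcover : ({C | ¬ ContainsPattern P C ∧ IsGeneric p μ C} :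
      Finset (G.EdgeLabeling (Fin 3))) ⊆ 𝒮.biUnion 𝓕 := by
    intro C hC
    have hC' := (mem_filter.1 hC).2
    refine mem_biUnion.2 ⟨S C, mem_filter.2 ⟨mem_univ _, fun i => ?_, ?_⟩,
      mem_filter.2 ⟨mem_univ _, hC', rfl⟩⟩
    -- At least `3 * α` neighbours in a class force a frequent colour.
    · by_contra h
      rw [not_nonempty_iff_eq_empty] at h
      have hlt : ∀ c, (#{v | (C.labelGraph c).Adj x v ∧ p v = i} : ℝ) < α := by
        intro c
        by_contra! h'
        exact notMem_empty c (h ▸ mem_filter.2 ⟨mem_univ c, h'⟩)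
      have hsub : ({v | G.Adj x v ∧ p v = i} : Finset V) ⊆
          univ.biUnion fun c : Fin 3 => {v | (C.labelGraph c).Adj x v ∧ p v = i} := by
        intro v hv
        have hv' := (mem_filter.1 hv).2
        exact mem_biUnion.2 ⟨pairColour C x v, mem_univ _, mem_filter.2 ⟨mem_univ v,
          (labelGraph_adj_iff C).2 ⟨hv'.1, rfl⟩, hv'.2⟩⟩
      have h1 : (#{v | G.Adj x v ∧ p v = i} : ℝ) ≤
          ∑ c : Fin 3, (#{v | (C.labelGraph c).Adj x v ∧ p v = i} : ℝ) := by
        exact_mod_cast (card_le_card hsub).trans card_biUnion_le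
      rw [Fin.sum_univ_three] at h1
      linarith [hx i, hlt 0, hlt 1, hlt 2]
    · by_contra! h
      exact hC'.1 (hC'.2.containsPattern_of_star hr hP hμ x (S C)
        (fun i c hc => (mem_filter.1 hc).2) h)
  have hbound : ∀ L ∈ 𝒮, (#(𝓕 L) : ℝ) ≤ patternFreeCount 3 P (G.induce {x}ᶜ) *
      (q ^ (-(3 * r * α)) * ((1 + 3 * q) ^ Fintype.card V * (3 ^ (r - 1) - 1) ^ M)) := by
    intro L hL
    obtain ⟨hLne, hLprod⟩ := (mem_filter.1 hL).2
    have h1 := card_le_patternFreeCount_induce_mul (P := P) {x} (𝓕 L)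
      (fun C hC => (mem_filter.1 hC).2.1.1) (fun C v => pairColour C x v) (by
        rintro C C' h _ rfl y hy
        rw [← pairColour_of_adj C hy, ← pairColour_of_adj C' hy]
        exact congrFun h y)
    -- At a neighbour `v` of `x` the rare colours are those outside `L (p v)`; at other vertices the
    -- colour is the junk value `0`.
    have h2 := card_rare_le (fun v => if G.Adj x v then univ else {0})
      (fun v => if G.Adj x v then (L (p v))ᶜ else ∅) (s := 3 * r * α) hq hq1
      ((𝓕 L).image fun C v => pairColour C x v) (by
        intro f hf
        obtain ⟨C, hC, rfl⟩ := mem_image.1 hf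
        refine ⟨pairColour_mem C x, ?_⟩
        have hCL := (mem_filter.1 hC).2.2
        have hsub : ({v | pairColour C x v ∈ (if G.Adj x v then (L (p v))ᶜ else ∅)} : Finset V) ⊆
            univ.biUnion fun i => (L i)ᶜ.biUnion fun c =>
              {v | (C.labelGraph c).Adj x v ∧ p v = i} := by
          intro v hv
          have hv' := (mem_filter.1 hv).2
          by_cases hadj : G.Adj x v
          · rw [if_pos hadj] at hv'
            exact mem_biUnion.2 ⟨p v, mem_univ _, mem_biUnion.2 ⟨_, hv', mem_filter.2
              ⟨mem_univ v, (labelGraph_adj_iff C).2 ⟨hadj, rfl⟩, rfl⟩⟩⟩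
          · simp [hadj] at hv'
        have hle : ∀ i, ∀ c ∈ (L i)ᶜ,
            (#{v | (C.labelGraph c).Adj x v ∧ p v = i} : ℝ) ≤ α := by
          intro i c hc
          rw [← hCL, mem_compl] at hc
          by_contra! h'
          exact hc (mem_filter.2 ⟨mem_univ c, h'.le⟩)
        have hα0 : 0 ≤ α := by positivity
        calc (#{v | pairColour C x v ∈ (if G.Adj x v then (L (p v))ᶜ else ∅)} : ℝ)
            ≤ ((∑ i, ∑ c ∈ (L i)ᶜ, #{v | (C.labelGraph c).Adj x v ∧ p v = i} : ℕ) : ℝ) := by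
              exact_mod_cast (card_le_card hsub).trans (card_biUnion_le.trans
                (sum_le_sum fun i _ => card_biUnion_le))
          _ ≤ ∑ i : Fin r, ∑ c ∈ (L i)ᶜ, α := by
              push_cast
              exact sum_le_sum fun i _ => sum_le_sum (hle i)
          _ ≤ ∑ i : Fin r, 3 * α := by
              refine sum_le_sum fun i _ => ?_
              rw [sum_const, nsmul_eq_mul]
              have : #(L i)ᶜ ≤ 3 := (card_le_univ _).trans (by simp)
              gcongr
              exact_mod_cast this
          _ = 3 * r * α := by
              rw [sum_const, card_univ, Fintype.card_fin, nsmul_eq_mul]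
              ring)
    have h3 : ∏ v, ((#((if G.Adj x v then univ else {0} : Finset (Fin 3)) \
          (if G.Adj x v then (L (p v))ᶜ else ∅)) : ℝ) +
        q * #((if G.Adj x v then univ else {0} : Finset (Fin 3)) ∩
          (if G.Adj x v then (L (p v))ᶜ else ∅))) ≤
        ∏ v, ((1 + 3 * q) * (#(L (p v)) : ℝ)) := by
      refine prod_le_prod (fun v _ => by positivity) fun v _ => ?_
      have hc1 : (1 : ℝ) ≤ #(L (p v)) := by exact_mod_cast (hLne (p v)).card_pos
      by_cases hadj : G.Adj x v
      · simp only [hadj, if_true, univ_inter]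
        rw [← compl_eq_univ_sdiff, compl_compl]
        have hc2 : (#(L (p v))ᶜ : ℝ) ≤ 3 := by
          have : #(L (p v))ᶜ ≤ 3 := (card_le_univ _).trans (by simp)
          exact_mod_cast this
        nlinarith
      · simp only [hadj, if_false, sdiff_empty, inter_empty, card_singleton, card_empty]
        push_cast
        nlinarith
    have h4 : ∏ v, ((1 + 3 * q) * (#(L (p v)) : ℝ)) ≤
        (1 + 3 * q) ^ Fintype.card V * (3 ^ (r - 1) - 1) ^ M := by
      rw [prod_mul_distrib, prod_const, card_univ,
        prod_comp_eq_prod_pow p (fun i => (#(L i) : ℝ))]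
      gcongr
      calc ∏ i, (#(L i) : ℝ) ^ #{v | p v = i} ≤ ∏ i, (#(L i) : ℝ) ^ M := by
            refine prod_le_prod (fun i _ => pow_nonneg (Nat.cast_nonneg _) _) fun i _ => ?_
            exact pow_le_pow_right₀ (by exact_mod_cast (hLne i).card_pos) (hM i)
        _ = (∏ i, (#(L i) : ℝ)) ^ M := by rw [prod_pow]
        _ ≤ _ := by
            refine pow_le_pow_left₀ (prod_nonneg fun i _ => Nat.cast_nonneg _) ?_ M
            have : (∏ i, (#(L i) : ℝ)) + 1 ≤ 3 ^ (r - 1) := by exact_mod_cast hLprod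
            linarith
    calc (#(𝓕 L) : ℝ) ≤ patternFreeCount 3 P (G.induce {x}ᶜ) *
          (#((𝓕 L).image fun C v => pairColour C x v) : ℝ) := by exact_mod_cast h1
      _ ≤ _ := by
          gcongr
          refine h2.trans ?_
          gcongr
          exact h3.trans h4
  have h31 : (0 : ℝ) ≤ 3 ^ (r - 1) - 1 := by
    have : (1 : ℝ) ≤ 3 ^ (r - 1) := one_le_pow₀ (by norm_num)
    linarith
  calc (#{C : G.EdgeLabeling (Fin 3) | ¬ ContainsPattern P C ∧ IsGeneric p μ C} : ℝ)
      ≤ ((∑ L ∈ 𝒮, #(𝓕 L) : ℕ) : ℝ) := by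
        exact_mod_cast (card_le_card hcover).trans card_biUnion_le
    _ ≤ ∑ L ∈ 𝒮, (patternFreeCount 3 P (G.induce {x}ᶜ) : ℝ) *
      (q ^ (-(3 * r * α)) * ((1 + 3 * q) ^ Fintype.card V * (3 ^ (r - 1) - 1) ^ M)) := by
        push_cast
        exact sum_le_sum hbound
    _ = #𝒮 * ((patternFreeCount 3 P (G.induce {x}ᶜ) : ℝ) *
      (q ^ (-(3 * r * α)) * ((1 + 3 * q) ^ Fintype.card V * (3 ^ (r - 1) - 1) ^ M))) := by
        rw [sum_const, nsmul_eq_mul]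
    _ ≤ 8 ^ r * ((patternFreeCount 3 P (G.induce {x}ᶜ) : ℝ) *
      (q ^ (-(3 * r * α)) * ((1 + 3 * q) ^ Fintype.card V * (3 ^ (r - 1) - 1) ^ M))) := by
        gcongr
        have : #𝒮 ≤ 8 ^ r := (card_le_univ _).trans (by simp)
        exact_mod_cast this
    _ = _ := by ring

/-- If the edge `xy` lies inside a class then, by `IsGeneric.containsPattern_of_edge`, one of the
nine pairs of colours is rare on the edges from `x` and `y` to some other class. -/
theorem card_generic_le_of_edge {V : Type*} [Fintype V] {r : ℕ}
    {G : SimpleGraph V} {P : EdgePattern (⊤ : SimpleGraph (Fin (r + 1)))} (hP : P.numClasses ≤ 3)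
    (p : V → Fin r) {μ : ℝ} (hμ : 0 < μ) {x y : V} (hxy : G.Adj x y) (hpxy : p x = p y) {b M L : ℕ}
    (hbx : #{v | G.Adj x v ∧ p v = p x} ≤ b) (hby : #{v | G.Adj y v ∧ p v = p x} ≤ b)
    (hM : #{v | p v ≠ p x} ≤ M) (hL : ∀ i, L ≤ #{v | p v = i}) :
    (#{C : G.EdgeLabeling (Fin 3) | ¬ ContainsPattern P C ∧ IsGeneric p μ C} : ℝ) ≤
      patternFreeCount 3 P (G.induce {x, y}ᶜ) * (3 * r * ((1 / 2 : ℝ) ^ (-(16 ^ r * μ)) *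
        (9 ^ b * 9 ^ M * (17 / 18) ^ L))) := by
  set α : ℝ := 16 ^ r * μ with hα
  set i₀ := p x with hi₀
  have hne : (0 : Fin (r + 1)) ≠ i₀.succ := (Fin.succ_ne_zero i₀).symm
  have hτ : ∀ a : Fin 3, ∃ τ : Quotient P → Fin 3, Injective τ ∧ patternColour τ 0 i₀.succ = a := by
    intro a
    obtain ⟨τ, hτ, h, -⟩ := exists_injective_classes hP
      (q := Quotient.mk P ⟨s(0, i₀.succ), hne⟩) (q' := Quotient.mk P ⟨s(0, i₀.succ), hne⟩)
      (c := a) (c' := a) (by simp)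
    exact ⟨τ, hτ, (patternColour_of_ne τ hne).trans h⟩
  choose τ hτinj hτa using hτ
  -- In a copy with `x`, `y` in the roles of `0` and `i₀.succ`, and with `z.1` the colour of `xy`, the
  -- vertex chosen from the class `z.2` has to see `x` and `y` in the colours `c z`.
  let c : Fin 3 × Fin r → Fin 3 × Fin 3 := fun z =>
    (patternColour (τ z.1) 0 z.2.succ, patternColour (τ z.1) i₀.succ z.2.succ)
  let rare : G.EdgeLabeling (Fin 3) → Fin 3 × Fin r → Finset V := fun C z =>
    {v | ((C.labelGraph (c z).1).Adj x v ∧ (C.labelGraph (c z).2).Adj y v) ∧ p v = z.2}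
  let 𝓕 : Fin 3 × Fin r → Finset (G.EdgeLabeling (Fin 3)) := fun z =>
    {C | (¬ ContainsPattern P C ∧ IsGeneric p μ C) ∧ (#(rare C z) : ℝ) < α}
  let 𝒵 : Finset (Fin 3 × Fin r) := {z | z.2 ≠ i₀}
  have hcover : ({C | ¬ ContainsPattern P C ∧ IsGeneric p μ C} :
      Finset (G.EdgeLabeling (Fin 3))) ⊆ 𝒵.biUnion 𝓕 := by
    intro C hC
    have hC' := (mem_filter.1 hC).2
    by_contra hnot
    refine hC'.1 (hC'.2.containsPattern_of_edge hμ (x := x) (y := y) i₀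
      (hτinj (pairColour C x y)) ?_ fun i hi => ?_)
    · rw [hτa]
      exact (labelGraph_adj_iff C).2 ⟨hxy, rfl⟩
    · by_contra! h
      exact hnot (mem_biUnion.2 ⟨(pairColour C x y, i), mem_filter.2 ⟨mem_univ _, hi⟩,
        mem_filter.2 ⟨mem_univ _, hC', h⟩⟩)
  let T : V → Finset (Fin 3 × Fin 3) := fun v =>
    (if G.Adj x v then univ else {0}) ×ˢ (if G.Adj y v then univ else {0})
  have hbound : ∀ z ∈ 𝒵, (#(𝓕 z) : ℝ) ≤ patternFreeCount 3 P (G.induce {x, y}ᶜ) *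
      ((1 / 2 : ℝ) ^ (-α) * (9 ^ b * 9 ^ M * (17 / 18) ^ L)) := by
    intro z hz
    have hz' : z.2 ≠ i₀ := (mem_filter.1 hz).2
    let R : V → Finset (Fin 3 × Fin 3) := fun v =>
      if (G.Adj x v ∧ G.Adj y v) ∧ p v = z.2 then {c z} else ∅
    have h1 := card_le_patternFreeCount_induce_mul (P := P) {x, y} (𝓕 z)
      (fun C hC => (mem_filter.1 hC).2.1.1) (fun C v => (pairColour C x v, pairColour C y v)) (by
        rintro C C' h w hw v hv
        have hv' := Prod.ext_iff.1 (congrFun h v)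
        rw [← pairColour_of_adj C hv, ← pairColour_of_adj C' hv]
        rcases hw with rfl | hw
        · exact hv'.1
        · rw [Set.mem_singleton_iff] at hw
          rw [hw]
          exact hv'.2)
    have h2 := card_rare_le T R (q := 1 / 2) (s := α) (by norm_num) (by norm_num)
      ((𝓕 z).image fun C v => (pairColour C x v, pairColour C y v)) (by
        intro f hf
        obtain ⟨C, hC, rfl⟩ := mem_image.1 hf
        refine ⟨fun v => mem_product.2 ⟨pairColour_mem C x v, pairColour_mem C y v⟩, ?_⟩
        refine le_trans ?_ (mem_filter.1 hC).2.2.le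
        refine Nat.cast_le.2 (card_le_card fun v hv => ?_)
        have hv' := (mem_filter.1 hv).2
        by_cases hadj : (G.Adj x v ∧ G.Adj y v) ∧ p v = z.2
        · simp only [R, if_pos hadj, mem_singleton, Prod.ext_iff] at hv'
          exact mem_filter.2 ⟨mem_univ v, ⟨(labelGraph_adj_iff C).2 ⟨hadj.1.1, hv'.1⟩,
            (labelGraph_adj_iff C).2 ⟨hadj.1.2, hv'.2⟩⟩, hadj.2⟩
        · simp [R, hadj] at hv')
    have hTcard : ∀ v, (#(T v) : ℝ) =
        (if G.Adj x v then 3 else 1) * (if G.Adj y v then 3 else 1) := by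
      intro v
      simp only [T, card_product]
      by_cases h : G.Adj x v <;> by_cases h' : G.Adj y v <;> norm_num [h, h']
    -- A common neighbour in the class `z.2` has weight `8 + 1 / 2 = 9 * (17 / 18)`.
    have hw : ∀ v, ((#(T v \ R v) : ℝ) + 1 / 2 * #(T v ∩ R v)) ≤
        ((if p v = i₀ ∧ G.Adj x v then 3 else 1) * (if p v = i₀ ∧ G.Adj y v then 3 else 1) *
          (if p v ≠ i₀ then 9 else 1)) * (if p v = z.2 then 17 / 18 else 1) := by
      intro v
      by_cases hR : (G.Adj x v ∧ G.Adj y v) ∧ p v = z.2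
      · have hv : p v ≠ i₀ := fun e => hz' (hR.2.symm.trans e)
        have hTu : T v = univ := by simp [T, hR.1.1, hR.1.2]
        simp only [R, if_pos hR, hTu, univ_inter, card_singleton]
        rw [← compl_eq_univ_sdiff, card_compl]
        simp only [hR.2, card_singleton, Fintype.card_prod, Fintype.card_fin, hz', false_and,
          if_false, if_true, ne_eq, not_false_eq_true]
        norm_num
      · simp only [R, if_neg hR, sdiff_empty, inter_empty, card_empty, hTcard]
        by_cases h3 : p v = z.2
        · have hv : p v ≠ i₀ := fun e => hz' (h3.symm.trans e)
          by_cases h4 : G.Adj x v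
          · have h5 : ¬ G.Adj y v := fun h => hR ⟨⟨h4, h⟩, h3⟩
            simp [h3, h4, h5, hz']
            norm_num
          · by_cases h5 : G.Adj y v <;> simp [h3, h4, h5, hz'] <;> norm_num
        · by_cases hv : p v = i₀
          · by_cases h4 : G.Adj x v <;> by_cases h5 : G.Adj y v <;> simp [hv, h4, h5, hz'.symm]
          · by_cases h4 : G.Adj x v <;> by_cases h5 : G.Adj y v <;> simp [hv, h3, h4, h5] <;>
              norm_num
    have h3 : ∏ v, ((#(T v \ R v) : ℝ) + 1 / 2 * #(T v ∩ R v)) ≤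
        9 ^ b * 9 ^ M * (17 / 18) ^ L := by
      refine (prod_le_prod (fun v _ => by positivity) fun v _ => hw v).trans ?_
      simp only [prod_mul_distrib, prod_ite, prod_const, one_pow, mul_one]
      have e1 : #{v | p v = i₀ ∧ G.Adj x v} ≤ b := by
        simpa only [and_comm] using hbx
      have e2 : #{v | p v = i₀ ∧ G.Adj y v} ≤ b := by
        simpa only [and_comm] using hby
      have e3 : (9 : ℝ) ^ b = 3 ^ b * 3 ^ b := by rw [← mul_pow]; norm_num
      rw [e3]
      have e4 := pow_le_pow_right₀ (by norm_num : (1 : ℝ) ≤ 3) e1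
      have e5 := pow_le_pow_right₀ (by norm_num : (1 : ℝ) ≤ 3) e2
      have e6 := pow_le_pow_right₀ (by norm_num : (1 : ℝ) ≤ 9) hM
      have e7 := pow_le_pow_of_le_one (by norm_num : (0 : ℝ) ≤ 17 / 18) (by norm_num) (hL z.2)
      exact mul_le_mul (mul_le_mul (mul_le_mul e4 e5 (by positivity) (by positivity)) e6
        (by positivity) (by positivity)) e7 (by positivity) (by positivity)
    calc (#(𝓕 z) : ℝ) ≤ patternFreeCount 3 P (G.induce {x, y}ᶜ) *
          (#((𝓕 z).image fun C v => (pairColour C x v, pairColour C y v)) : ℝ) := by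
            exact_mod_cast h1
      _ ≤ _ := by
          gcongr
          refine h2.trans ?_
          gcongr
  calc (#{C : G.EdgeLabeling (Fin 3) | ¬ ContainsPattern P C ∧ IsGeneric p μ C} : ℝ)
      ≤ ((∑ z ∈ 𝒵, #(𝓕 z) : ℕ) : ℝ) := by
        exact_mod_cast (card_le_card hcover).trans card_biUnion_le
    _ ≤ ∑ z ∈ 𝒵, (patternFreeCount 3 P (G.induce {x, y}ᶜ) : ℝ) *
      ((1 / 2 : ℝ) ^ (-α) * (9 ^ b * 9 ^ M * (17 / 18) ^ L)) := by
        push_cast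
        exact sum_le_sum hbound
    _ = #𝒵 * ((patternFreeCount 3 P (G.induce {x, y}ᶜ) : ℝ) *
      ((1 / 2 : ℝ) ^ (-α) * (9 ^ b * 9 ^ M * (17 / 18) ^ L))) := by
        rw [sum_const, nsmul_eq_mul]
    _ ≤ (3 * r) * ((patternFreeCount 3 P (G.induce {x, y}ᶜ) : ℝ) *
      ((1 / 2 : ℝ) ^ (-α) * (9 ^ b * 9 ^ M * (17 / 18) ^ L))) := by
        gcongr
        have : #𝒵 ≤ 3 * r := (card_le_univ _).trans (by simp)
        exact_mod_cast this
    _ = _ := by ring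

/-! ### The choice of constants -/

theorem eventually_mul_lt_nhdsGT_zero (A : ℝ) {γ : ℝ} (hγ : 0 < γ) :
    ∀ᶠ x in 𝓝[>] (0 : ℝ), x * A < γ := by
  have h : Tendsto (fun x : ℝ => x * A) (𝓝[>] 0) (𝓝 (0 * A)) :=
    (tendsto_id.mono_left nhdsWithin_le_nhds).mul_const A
  rw [zero_mul] at h
  exact h.eventually_lt_const hγ

theorem eventually_le_mul_natCast (A : ℝ) {γ : ℝ} (hγ : 0 < γ) :
    ∀ᶠ n : ℕ in atTop, A ≤ γ * n :=
  (tendsto_natCast_atTop_atTop.const_mul_atTop hγ).eventually_ge_atTop A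

theorem log_three_pow_sub_one_lt {r : ℕ} (hr : 2 ≤ r) :
    0 ≤ Real.log (3 ^ (r - 1) - 1) ∧
      Real.log ((3 : ℝ) ^ (r - 1) - 1) < (r - 1) * Real.log 3 := by
  have h : (3 : ℝ) ≤ 3 ^ (r - 1) := by
    calc (3 : ℝ) = 3 ^ 1 := by norm_num
      _ ≤ 3 ^ (r - 1) := pow_le_pow_right₀ (by norm_num) (by omega)
  refine ⟨Real.log_nonneg (by linarith), ?_⟩
  have h1 : Real.log ((3 : ℝ) ^ (r - 1) - 1) < Real.log ((3 : ℝ) ^ (r - 1)) :=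
    Real.log_lt_log (by linarith) (by linarith)
  rwa [Real.log_pow, Nat.cast_sub (by omega), Nat.cast_one] at h1

/-- The constants of the argument: `q` is the weight of rare colours, `ε * n` the threshold for
genericity, `η * n` the deviation of the class sizes from `n / r`, and `δ * n ^ 2` the number of
inner edges. -/
theorem exists_constants {r : ℕ} (hr : 2 ≤ r) (K : ℝ) :
    ∃ q ε η δ : ℝ, 0 < q ∧ q ≤ 1 ∧ 0 < ε ∧ 0 < η ∧ 0 < δ ∧ δ ≤ ε ^ 2 / 2 ∧
      ∀ᶠ n : ℕ in atTop,
        Real.log 6 + r * Real.log 8 - 3 * r * (16 ^ r * (ε * n)) * Real.log q + 3 * q * n +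
            (n / r + η * n) * Real.log (3 ^ (r - 1) - 1) ≤
          ((1 - 1 / r) * n - K) * Real.log 3 ∧
        Real.log 6 + Real.log (3 * r) + 16 ^ r * (ε * n) * Real.log 2 +
            (3 * (16 ^ r * (ε * n)) + (n - n / r + η * n)) * Real.log 9 -
            (n / r - η * n) * Real.log (18 / 17) ≤
          (2 * (1 - 1 / r) * n - K) * Real.log 3 ∧
        Real.log 6 + n * Real.log 4 + δ * n ^ 2 * Real.log 3 - (ε * n) ^ 2 / 16 * Real.log 2 ≤ 0 ∧
        (r : ℝ) ^ 2 + 2 + 2 * (δ * n ^ 2) ≤ (η * n) ^ 2 := by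
  have hr0 : (0 : ℝ) < r := by exact_mod_cast (show 0 < r by omega)
  obtain ⟨hl0, hl1⟩ := log_three_pow_sub_one_lt hr
  set l := Real.log ((3 : ℝ) ^ (r - 1) - 1) with hl
  -- The exponential gain at a vertex is `4 * γ * n`, at an edge it is `h / r * n`; it is split evenly
  -- among the error terms.
  set γ : ℝ := ((r - 1) * Real.log 3 - l) / (4 * r) with hγ
  have hγ0 : 0 < γ := div_pos (by linarith) (by positivity)
  have hγe : (r - 1) * Real.log 3 - l = 4 * r * γ := by rw [hγ]; field_simp
  set h := Real.log (18 / 17) with hh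
  have hh0 : 0 < h := Real.log_pos (by norm_num)
  have h3 : 0 < h / (3 * r) := by positivity
  have hlog2 : 0 < Real.log 2 := Real.log_pos (by norm_num)
  have hlog9 : Real.log 9 = 2 * Real.log 3 := by
    rw [show (9 : ℝ) = 3 ^ 2 by norm_num, Real.log_pow]
    norm_num
  obtain ⟨q, hq1, hq2, hq0⟩ := ((eventually_mul_lt_nhdsGT_zero 1 one_pos).and
    ((eventually_mul_lt_nhdsGT_zero 3 hγ0).and self_mem_nhdsWithin)).exists
  obtain ⟨ε, hε1, hε2, hε0⟩ := ((eventually_mul_lt_nhdsGT_zero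
    (-(3 * r * 16 ^ r * Real.log q)) hγ0).and ((eventually_mul_lt_nhdsGT_zero
    (16 ^ r * Real.log 2 + 3 * 16 ^ r * Real.log 9) h3).and self_mem_nhdsWithin)).exists
  obtain ⟨η, hη1, hη2, hη0⟩ := ((eventually_mul_lt_nhdsGT_zero l hγ0).and
    ((eventually_mul_lt_nhdsGT_zero (Real.log 9 + h) h3).and self_mem_nhdsWithin)).exists
  replace hq0 : 0 < q := hq0
  replace hε0 : 0 < ε := hε0
  replace hη0 : 0 < η := hη0
  have hε2' : 0 < ε ^ 2 / 2 := by positivity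
  have hε3 : 0 < ε ^ 2 * Real.log 2 / 32 := by positivity
  have hη3 : 0 < η ^ 2 / 2 := by positivity
  obtain ⟨δ, hδ1, hδ2, hδ3, hδ0⟩ := ((eventually_mul_lt_nhdsGT_zero 1 hε2').and
    ((eventually_mul_lt_nhdsGT_zero (Real.log 3) hε3).and
    ((eventually_mul_lt_nhdsGT_zero 2 hη3).and self_mem_nhdsWithin))).exists
  replace hδ0 : 0 < δ := hδ0
  refine ⟨q, ε, η, δ, hq0, by linarith, hε0, hη0, hδ0, by linarith, ?_⟩
  filter_upwards [eventually_le_mul_natCast (Real.log 6 + r * Real.log 8 + K * Real.log 3) hγ0,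
    eventually_le_mul_natCast (Real.log 6 + Real.log (3 * r) + K * Real.log 3) h3,
    eventually_le_mul_natCast (Real.log 6 + Real.log 4) hε3,
    eventually_le_mul_natCast ((r : ℝ) ^ 2 + 2) hη3, eventually_ge_atTop 1] with n h1 h2 h4 h5 h6
  have hn1 : (1 : ℝ) ≤ n := by exact_mod_cast h6
  have hn0 : (0 : ℝ) ≤ n := by linarith
  refine ⟨?_, ?_, ?_, ?_⟩
  · have e1 := mul_le_mul_of_nonneg_right hq2.le hn0
    have e2 := mul_le_mul_of_nonneg_right hε1.le hn0
    have e3 := mul_le_mul_of_nonneg_right hη1.le hn0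
    have e4 : (1 - 1 / r) * n * Real.log 3 - n / r * l = 4 * γ * n := by
      calc (1 - 1 / r) * n * Real.log 3 - n / r * l = ((r - 1) * Real.log 3 - l) * n / r := by
            field_simp
        _ = _ := by rw [hγe]; field_simp
    linarith
  · have e1 := mul_le_mul_of_nonneg_right hε2.le hn0
    have e2 := mul_le_mul_of_nonneg_right hη2.le hn0
    have e3 : n / r * h = 3 * (h / (3 * r) * n) := by field_simp
    have e4 : (n - n / r : ℝ) * Real.log 9 = 2 * (1 - 1 / r) * n * Real.log 3 := by
      rw [hlog9]
      ring
    linarith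
  · have e1 := mul_le_mul_of_nonneg_right hδ2.le (sq_nonneg (n : ℝ))
    have e2 := mul_le_mul_of_nonneg_right h4 hn0
    have e3 : Real.log 6 ≤ Real.log 6 * n :=
      le_mul_of_one_le_right (Real.log_nonneg (by norm_num)) hn1
    linarith
  · have e1 := mul_le_mul_of_nonneg_right hδ3.le (sq_nonneg (n : ℝ))
    have e2 : (n : ℝ) ≤ n ^ 2 := by nlinarith
    have e3 := mul_le_mul_of_nonneg_left e2 hη3.le
    linarith

/-! ### Removing one or two vertices -/

/-- The increment `t(n + d) - t(n)` of the Turán numbers is at least `d * (1 - 1 / r) * (n + d)` up to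
a constant. -/
theorem rpow_mul_pow_extremalNumber_le {r n d : ℕ} (hr : 1 ≤ r) (hd : d ≤ 2) :
    (3 : ℝ) ^ (d * (1 - 1 / (r : ℝ)) * (n + d : ℕ) - (r ^ 2 + 4)) *
        3 ^ SimpleGraph.extremalNumber n (⊤ : SimpleGraph (Fin (r + 1))) ≤
      3 ^ SimpleGraph.extremalNumber (n + d) (⊤ : SimpleGraph (Fin (r + 1))) := by
  rw [← Real.rpow_natCast 3 (SimpleGraph.extremalNumber n _),
    ← Real.rpow_natCast 3 (SimpleGraph.extremalNumber (n + d) _), ← Real.rpow_add (by norm_num)]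
  refine Real.rpow_le_rpow_of_exponent_le (x := 3) (by norm_num) ?_
  have h1 := two_mul_extremalNumber_le n hr
  have h2 := le_two_mul_extremalNumber (n + d) hr
  set t := (SimpleGraph.extremalNumber n (⊤ : SimpleGraph (Fin (r + 1))) : ℝ)
  set t' := (SimpleGraph.extremalNumber (n + d) (⊤ : SimpleGraph (Fin (r + 1))) : ℝ)
  have hr1 : (1 : ℝ) ≤ r := by exact_mod_cast hr
  have hd2 : (d : ℝ) ≤ 2 := by exact_mod_cast hd
  have hd0 : (0 : ℝ) ≤ d := by positivity
  refine le_of_mul_le_mul_left ?_ (show (0 : ℝ) < 2 * r by linarith)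
  have h3 : 2 * (r : ℝ) * (d * (1 - 1 / r) * (n + d : ℕ) - (r ^ 2 + 4) + t) =
      2 * d * (r - 1) * (n + d : ℕ) - 2 * r * (r ^ 2 + 4) + 2 * r * t := by
    field_simp
  rw [h3]
  push_cast at h2 ⊢
  have h4 : (d : ℝ) ^ 2 ≤ 4 := by nlinarith
  have h5 : ((r : ℝ) - 1) * d ^ 2 ≤ (r - 1) * 4 := mul_le_mul_of_nonneg_left h4 (by linarith)
  have h6 : (0 : ℝ) ≤ r ^ 3 := by positivity
  nlinarith

theorem exists_fin_patternFreeCount_eq {W V : Type*} {F : SimpleGraph W} [Fintype V] (s : ℕ)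
    (P : EdgePattern F) (G : SimpleGraph V) {n : ℕ} (hn : Fintype.card V = n) :
    ∃ G' : SimpleGraph (Fin n), patternFreeCount s P G' = patternFreeCount s P G :=
  ⟨G.overFin hn, patternFreeCount_congr (G.overFinIso hn).symm⟩

/-- Here `c` stands for the number of pattern-free colourings of `G` without `d` vertices. If at most
half of the pattern-free colourings of `G` are not generic and there are at most `c * B` generic ones,
where `B` is small, then `c` is large compared to the count for the Turán graph on `n` vertices. -/
theorem pow_le_patternFreeCount_of_card_le {r n d m : ℕ} (hr : 1 ≤ r) (hd : d ≤ 2)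
    {V : Type*} [Fintype V] {P : EdgePattern (⊤ : SimpleGraph (Fin (r + 1)))} {G : SimpleGraph V}
    {c : ℕ} {p : V → Fin r} {μ B : ℝ}
    (hc : 3 ^ (SimpleGraph.extremalNumber (n + d) (⊤ : SimpleGraph (Fin (r + 1))) + m) ≤
      patternFreeCount 3 P G)
    (hbad : 2 * (#{C : G.EdgeLabeling (Fin 3) | ¬ IsGeneric p μ C} : ℝ) ≤
      3 ^ SimpleGraph.extremalNumber (n + d) (⊤ : SimpleGraph (Fin (r + 1))))
    (hgood : (#{C : G.EdgeLabeling (Fin 3) | ¬ ContainsPattern P C ∧ IsGeneric p μ C} : ℝ) ≤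
      c * B) (hB0 : 0 < B)
    (hB : 6 * B ≤ 3 ^ (d * (1 - 1 / (r : ℝ)) * (n + d : ℕ) - (r ^ 2 + 4))) :
    3 ^ (SimpleGraph.extremalNumber n (⊤ : SimpleGraph (Fin (r + 1))) + m + 1) ≤ c := by
  set t := SimpleGraph.extremalNumber (n + d) (⊤ : SimpleGraph (Fin (r + 1)))
  set t' := SimpleGraph.extremalNumber n (⊤ : SimpleGraph (Fin (r + 1)))
  have h1 : (patternFreeCount 3 P G : ℝ) ≤
      #{C : G.EdgeLabeling (Fin 3) | ¬ IsGeneric p μ C} +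
      #{C : G.EdgeLabeling (Fin 3) | ¬ ContainsPattern P C ∧ IsGeneric p μ C} := by
    rw [patternFreeCount_eq_card]
    norm_cast
    refine (card_le_card fun C hC => ?_).trans (card_union_le _ _)
    have hC' := (mem_filter.1 hC).2
    by_cases h : IsGeneric p μ C
    · exact mem_union_right _ (mem_filter.2 ⟨mem_univ _, hC', h⟩)
    · exact mem_union_left _ (mem_filter.2 ⟨mem_univ _, h⟩)
  have h2 : (3 : ℝ) ^ (t + m) ≤ patternFreeCount 3 P G := by exact_mod_cast hc
  -- At least half of the pattern-free colourings are generic, hence the factor `6 = 2 * 3` in `hB`.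
  have h3 : (3 : ℝ) ^ t ≤ 3 ^ (t + m) := pow_le_pow_right₀ (by norm_num) (by omega)
  have h4 : (3 : ℝ) ^ (t + m) ≤ 2 * (c * B) := by linarith
  have h5 := rpow_mul_pow_extremalNumber_le (n := n) hr hd
  have h6 : 6 * B * 3 ^ t' ≤ 3 ^ t := le_trans (by gcongr) h5
  have h7 : 6 * B * 3 ^ t' * 3 ^ m ≤ 2 * (c * B) := by
    calc 6 * B * 3 ^ t' * 3 ^ m ≤ 3 ^ t * 3 ^ m := by gcongr
      _ = 3 ^ (t + m) := by rw [pow_add]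
      _ ≤ _ := h4
  have h8 : (3 : ℝ) ^ (t' + m + 1) * (2 * B) ≤ c * (2 * B) := by
    rw [pow_add, pow_add]
    linarith
  exact_mod_cast le_of_mul_le_mul_right h8 (by linarith)

/-- The bound of `card_generic_le_of_vertex` is small in the sense required by
`pow_le_patternFreeCount_of_card_le`. -/
theorem vertex_bound {r n M : ℕ} (hr : 2 ≤ r) {q ε η K : ℝ} (hq : 0 < q)
    (hM : (M : ℝ) ≤ n / r + η * n)
    (h : Real.log 6 + r * Real.log 8 - 3 * r * (16 ^ r * (ε * n)) * Real.log q + 3 * q * n +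
            (n / r + η * n) * Real.log (3 ^ (r - 1) - 1) ≤
          ((1 - 1 / r) * n - K) * Real.log 3) :
    6 * (8 ^ r * (q ^ (-(3 * r * (16 ^ r * (ε * n)))) *
      ((1 + 3 * q) ^ n * ((3 : ℝ) ^ (r - 1) - 1) ^ M))) ≤ 3 ^ ((1 - 1 / (r : ℝ)) * n - K) := by
  obtain ⟨hl0, -⟩ := log_three_pow_sub_one_lt hr
  have h3 : (0 : ℝ) < 3 ^ (r - 1) - 1 := by
    have : (1 : ℝ) < 3 ^ (r - 1) := one_lt_pow₀ (by norm_num) (by omega)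
    linarith
  refine Real.le_rpow_of_log_le (by norm_num) ?_
  rw [Real.log_mul (by norm_num) (by positivity), Real.log_mul (by positivity) (by positivity),
    Real.log_mul (by positivity) (by positivity), Real.log_mul (by positivity) (by positivity),
    Real.log_pow, Real.log_rpow hq, Real.log_pow, Real.log_pow]
  have h4 : Real.log (1 + 3 * q) ≤ 3 * q := by
    have := Real.log_le_sub_one_of_pos (show 0 < 1 + 3 * q by positivity)
    linarith
  have h5 := mul_le_mul_of_nonneg_left h4 (Nat.cast_nonneg (α := ℝ) n)
  have h6 := mul_le_mul_of_nonneg_right hM hl0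
  linarith

/-- The bound of `card_generic_le_of_edge` is small in the sense required by
`pow_le_patternFreeCount_of_card_le`. -/
theorem edge_bound {r n b M L : ℕ} (hr : 2 ≤ r) {ε η K : ℝ}
    (hb : (b : ℝ) ≤ 3 * (16 ^ r * (ε * n))) (hM : (M : ℝ) ≤ n - n / r + η * n)
    (hL : n / r - η * n ≤ (L : ℝ))
    (h : Real.log 6 + Real.log (3 * r) + 16 ^ r * (ε * n) * Real.log 2 +
            (3 * (16 ^ r * (ε * n)) + (n - n / r + η * n)) * Real.log 9 -
            (n / r - η * n) * Real.log (18 / 17) ≤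
          (2 * (1 - 1 / r) * n - K) * Real.log 3) :
    6 * (3 * r * ((1 / 2 : ℝ) ^ (-(16 ^ r * (ε * n))) * (9 ^ b * 9 ^ M * (17 / 18) ^ L))) ≤
      3 ^ (2 * (1 - 1 / (r : ℝ)) * n - K) := by
  have hr0 : (0 : ℝ) < r := by exact_mod_cast (show 0 < r by omega)
  refine Real.le_rpow_of_log_le (by norm_num) ?_
  rw [Real.log_mul (by norm_num) (by positivity),
    Real.log_mul (x := 3 * (r : ℝ)) (by positivity) (by positivity),
    Real.log_mul (x := (1 / 2 : ℝ) ^ _) (by positivity) (by positivity),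
    Real.log_mul (x := 9 ^ b * 9 ^ M) (by positivity) (by positivity),
    Real.log_mul (x := 9 ^ b) (by positivity) (by positivity),
    Real.log_rpow (by norm_num), Real.log_pow, Real.log_pow, Real.log_pow]
  have e1 : Real.log (1 / 2) = -Real.log 2 := by rw [one_div, Real.log_inv]
  have e2 : Real.log (17 / 18) = -Real.log (18 / 17) := by rw [← Real.log_inv]; norm_num
  rw [e1, e2]
  have h9 : 0 ≤ Real.log 9 := Real.log_nonneg (by norm_num)
  have h18 : 0 ≤ Real.log (18 / 17) := Real.log_nonneg (by norm_num)
  have h5 := mul_le_mul_of_nonneg_right hb h9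
  have h6 := mul_le_mul_of_nonneg_right hM h9
  have h7 := mul_le_mul_of_nonneg_right hL h18
  linarith

theorem two_mul_card_not_isGeneric_le {V : Type*} [Fintype V] {r n : ℕ} {G : SimpleGraph V}
    {p : V → Fin r} {ε δ : ℝ} (hV : Fintype.card V = n) (hn : 0 < n) (hε : 0 < ε)
    (hδ : δ ≤ ε ^ 2 / 2)
    (hG : SimpleGraph.extremalNumber n (⊤ : SimpleGraph (Fin (r + 1))) ≤ #G.edgeFinset)
    (hp : (#(innerGraph G p).edgeFinset : ℝ) ≤ δ * n ^ 2)
    (h : Real.log 6 + n * Real.log 4 + δ * n ^ 2 * Real.log 3 -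
      (ε * n) ^ 2 / 16 * Real.log 2 ≤ 0) :
    2 * (#{C : G.EdgeLabeling (Fin 3) | ¬ IsGeneric p (ε * n) C} : ℝ) ≤
      3 ^ SimpleGraph.extremalNumber n (⊤ : SimpleGraph (Fin (r + 1))) := by
  have hn' : (0 : ℝ) < n := by exact_mod_cast hn
  have hμ : 0 < ε * n := by positivity
  have h1 := card_not_isGeneric_le G p hμ (by
    intro X Y hXY hX hY
    have h2 := card_mul_card_le_interedges_add G p (by rwa [hV]) hXY
    have h3 : (#X * #Y : ℝ) ≤ #(G.interedges X Y) + #(innerGraph G p).edgeFinset := by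
      exact_mod_cast h2
    have h4 : (ε * n) * (ε * n) ≤ #X * #Y := mul_le_mul hX hY hμ.le (by positivity)
    have h5 := mul_le_mul_of_nonneg_right hδ (sq_nonneg (n : ℝ))
    linarith)
  have h2 := card_edgeFinset_le_extremalNumber_add_inner G p
  rw [hV] at h1 h2
  set t := SimpleGraph.extremalNumber n (⊤ : SimpleGraph (Fin (r + 1)))
  set s := #(innerGraph G p).edgeFinset
  have h3 : (3 : ℝ) ^ #G.edgeFinset ≤ 3 ^ t * 3 ^ s := by
    rw [← pow_add]
    exact pow_le_pow_right₀ (by norm_num) h2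
  have h4 : 6 * (4 ^ n * (3 ^ s * (2 : ℝ) ^ (-((ε * n) ^ 2 / 16)))) ≤ 1 := by
    rw [← Real.log_nonpos_iff (by positivity), Real.log_mul (by norm_num) (by positivity),
      Real.log_mul (by positivity) (by positivity), Real.log_mul (by positivity) (by positivity),
      Real.log_pow, Real.log_pow, Real.log_rpow (by norm_num)]
    have := mul_le_mul_of_nonneg_right hp (Real.log_nonneg (by norm_num : (1 : ℝ) ≤ 3))
    linarith
  calc 2 * (#{C : G.EdgeLabeling (Fin 3) | ¬ IsGeneric p (ε * n) C} : ℝ)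
      ≤ 2 * (3 * 4 ^ n * (3 ^ t * 3 ^ s * 2 ^ (-((ε * n) ^ 2 / 16)))) := by
        refine mul_le_mul_of_nonneg_left (h1.trans ?_) zero_le_two
        refine mul_le_mul_of_nonneg_left ?_ (by positivity)
        exact mul_le_mul_of_nonneg_right h3 (by positivity)
    _ = 3 ^ t * (6 * (4 ^ n * (3 ^ s * (2 : ℝ) ^ (-((ε * n) ^ 2 / 16))))) := by ring
    _ ≤ 3 ^ t * 1 := by gcongr
    _ = 3 ^ t := mul_one _

/-- The inductive step: a large graph that beats the Turán graph by a factor `3 ^ m` and is not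
`r`-partite, but has a partition with few inner edges, loses one or two vertices so that the
remaining graph beats the Turán graph by a factor `3 ^ (m + 1)`. -/
theorem exists_smaller_of_partition {r : ℕ} (hr : 2 ≤ r)
    {P : EdgePattern (⊤ : SimpleGraph (Fin (r + 1)))} (hP : P.numClasses ≤ 3) :
    ∃ δ : ℝ, 0 < δ ∧ ∃ n₀ : ℕ, ∀ n : ℕ, n₀ < n → ∀ (V : Type) [Fintype V],
      Fintype.card V = n → ∀ (G : SimpleGraph V) (m : ℕ),
      3 ^ (SimpleGraph.extremalNumber n (⊤ : SimpleGraph (Fin (r + 1))) + m) ≤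
        patternFreeCount 3 P G →
      (∃ p : V → Fin r,
        ((∑ i, (G.induce {v | p v = i}).edgeSet.ncard : ℕ) : ℝ) ≤ δ * (n : ℝ) ^ 2) →
      (∀ p : V → Fin r, ∃ u v, G.Adj u v ∧ p u = p v) →
      ∃ n' < n, n ≤ n' + 2 ∧ ∃ G' : SimpleGraph (Fin n'),
        3 ^ (SimpleGraph.extremalNumber n' (⊤ : SimpleGraph (Fin (r + 1))) + m + 1) ≤
          patternFreeCount 3 P G' := by
  -- `r ^ 2 + 4` is the loss in `rpow_mul_pow_extremalNumber_le`.
  obtain ⟨q, ε, η, δ, hq, hq1, hε, hη, hδ, hδε, hev⟩ := exists_constants hr ((r : ℝ) ^ 2 + 4)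
  obtain ⟨n₁, hn₁⟩ := eventually_atTop.1 hev
  refine ⟨δ, hδ, max n₁ 2, fun n hn V _ hV G m hc ⟨p₀, hp₀⟩ hpart => ?_⟩
  obtain ⟨hA, hB, hC, hD⟩ := hn₁ n (by omega)
  have hn' : (0 : ℝ) < n := by exact_mod_cast (show 0 < n by omega)
  set μ : ℝ := ε * n with hμ
  have hμ0 : 0 < μ := by positivity
  have hc0 : 3 ^ SimpleGraph.extremalNumber n (⊤ : SimpleGraph (Fin (r + 1))) ≤
      patternFreeCount 3 P G := (Nat.pow_le_pow_right (by norm_num) (by omega)).trans hc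
  have hG : SimpleGraph.extremalNumber n (⊤ : SimpleGraph (Fin (r + 1))) ≤ #G.edgeFinset :=
    (Nat.pow_le_pow_iff_right (by norm_num)).1 (hc0.trans (patternFreeCount_le 3 P G))
  have : Nonempty (V → Fin r) := ⟨p₀⟩
  obtain ⟨p, hp⟩ := Finite.exists_min fun p : V → Fin r => #(innerGraph G p).edgeFinset
  have hinner : (#(innerGraph G p).edgeFinset : ℝ) ≤ δ * n ^ 2 := by
    refine le_trans ?_ hp₀
    exact_mod_cast (hp p₀).trans (card_edgeFinset_innerGraph_le G p₀)
  have hbad := two_mul_card_not_isGeneric_le hV (by omega) hε hδε hG hinner hC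
  have hsize : ∀ i, |(#{v | p v = i} : ℝ) - n / r| ≤ η * n := by
    intro i
    have h1 := sq_card_class_sub_le G p (by omega) (by rwa [hV]) i
    rw [hV] at h1
    exact abs_le_of_sq_le_sq (by linarith) (by positivity)
  by_cases hx : ∃ x, 3 * (16 ^ r * μ) ≤ #{v | G.Adj x v ∧ p v = p x}
  · obtain ⟨x, hx⟩ := hx
    obtain ⟨n', rfl⟩ : ∃ n', n = n' + 1 := ⟨n - 1, by omega⟩
    obtain ⟨G', hG'⟩ := exists_fin_patternFreeCount_eq 3 P (G.induce {x}ᶜ) (n := n') (by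
      rw [Fintype.card_compl_set, hV]
      simp)
    refine ⟨n', by omega, by omega, G', ?_⟩
    have hM : ∀ i, #{v | p v = i} ≤ ⌊((n' + 1 : ℕ) : ℝ) / r + η * (n' + 1 : ℕ)⌋₊ := by
      intro i
      refine Nat.le_floor ?_
      have := (abs_le.1 (hsize i)).2
      linarith
    have hgood := card_generic_le_of_vertex (G := G) hr hP p hμ0 hq hq1 x (fun i =>
      hx.trans (Nat.cast_le.2 (by
        convert! card_neighbours_le_of_forall_innerGraph_le hp x i))) hM
    rw [hV, ← hG'] at hgood
    have h31 : (0 : ℝ) < 3 ^ (r - 1) - 1 := by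
      have : (1 : ℝ) < 3 ^ (r - 1) := one_lt_pow₀ (by norm_num) (by omega)
      linarith
    refine pow_le_patternFreeCount_of_card_le (by omega) (by norm_num) hc hbad hgood
      (by positivity) ?_
    rw [Nat.cast_one, one_mul]
    exact vertex_bound hr hq (Nat.floor_le (by positivity)) hA
  · push Not at hx
    obtain ⟨x, y, hxy, hpxy⟩ := hpart p
    obtain ⟨n', rfl⟩ : ∃ n', n = n' + 2 := ⟨n - 2, by omega⟩
    obtain ⟨G', hG'⟩ := exists_fin_patternFreeCount_eq 3 P (G.induce {x, y}ᶜ) (n := n') (by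
      rw [Fintype.card_compl_set, hV]
      simp [hxy.ne])
    refine ⟨n', by omega, by omega, G', ?_⟩
    have hby := hx y
    rw [← hpxy] at hby
    have hL : ∀ i, ⌈((n' + 2 : ℕ) : ℝ) / r - η * (n' + 2 : ℕ)⌉₊ ≤ #{v | p v = i} := by
      intro i
      refine Nat.ceil_le.2 ?_
      have := (abs_le.1 (hsize i)).1
      linarith
    have hM : (#{v | p v ≠ p x} : ℝ) ≤ (n' + 2 : ℕ) - (n' + 2 : ℕ) / r + η * (n' + 2 : ℕ) := by
      have h1 := (abs_le.1 (hsize (p x))).1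
      have h2 : (#{v | p v = p x} : ℝ) + #{v | p v ≠ p x} = (n' + 2 : ℕ) := by
        have := card_filter_add_card_filter_not (s := univ) (fun v => p v = p x)
        rw [card_univ, hV] at this
        exact_mod_cast this
      linarith
    have hgood := card_generic_le_of_edge hP p hμ0 hxy hpxy (Nat.le_floor (hx x).le)
      (Nat.le_floor hby.le) le_rfl hL
    rw [← hG'] at hgood
    have hr0 : (0 : ℝ) < r := by exact_mod_cast (show 0 < r by omega)
    refine pow_le_patternFreeCount_of_card_le (by omega) le_rfl hc hbad hgood
      ?_ ?_
    · positivity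
    rw [Nat.cast_two]
    exact edge_bound hr (Nat.floor_le (by positivity)) hM (Nat.le_ceil _) hB

/-! ### Iteration -/

/-- For patterns with the stability property the inductive step applies to every large graph that is
not `r`-partite. -/
theorem exists_smaller_of_not_partite {r : ℕ} (hr : 2 ≤ r)
    {P : EdgePattern (⊤ : SimpleGraph (Fin (r + 1)))} (hP : ThreeStability P) :
    ∃ n₀ : ℕ, ∀ n : ℕ, n₀ < n → ∀ (G : SimpleGraph (Fin n)) (m : ℕ),
      3 ^ (SimpleGraph.extremalNumber n (⊤ : SimpleGraph (Fin (r + 1))) + m) ≤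
        patternFreeCount 3 P G →
      (∀ p : Fin n → Fin r, ∃ u v, G.Adj u v ∧ p u = p v) →
      ∃ n' < n, n ≤ n' + 2 ∧ ∃ G' : SimpleGraph (Fin n'),
        3 ^ (SimpleGraph.extremalNumber n' (⊤ : SimpleGraph (Fin (r + 1))) + m + 1) ≤
          patternFreeCount 3 P G' := by
  obtain ⟨hP3, hstab⟩ := hP
  obtain ⟨δ, hδ, n₁, hn₁⟩ := exists_smaller_of_partition hr hP3
  obtain ⟨n₀, hn₀⟩ := hstab δ hδ
  refine ⟨max n₀ n₁, fun n hn G m hc hpart => ?_⟩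
  have hc0 : 3 ^ SimpleGraph.extremalNumber n (⊤ : SimpleGraph (Fin (r + 1))) ≤
      patternFreeCount 3 P G := (Nat.pow_le_pow_right (by norm_num) (by omega)).trans hc
  exact hn₁ n (by omega) (Fin n) (Fintype.card_fin n) G m hc (hn₀ n (by omega) G hc0) hpart

theorem patternFreeCount_eq_of_partite {V : Type*} [Fintype V] {r s : ℕ}
    {P : EdgePattern (⊤ : SimpleGraph (Fin (r + 1)))} {G : SimpleGraph V} {p : V → Fin r}
    (hp : ∀ u v, G.Adj u v → p u ≠ p v) :
    patternFreeCount s P G = s ^ #G.edgeFinset ∧ #G.edgeFinset ≤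
      SimpleGraph.extremalNumber (Fintype.card V) (⊤ : SimpleGraph (Fin (r + 1))) :=
  ⟨patternFreeCount_of_free s P (free_of_hom hp),
    SimpleGraph.card_edgeFinset_le_extremalNumber (free_of_hom hp)⟩

/-- Along the steps `2 * m + n` does not decrease, while for bounded `n` the number of colourings
bounds `m`. -/
theorem two_mul_add_le_of_pow_le {r n₀ : ℕ}
    {P : EdgePattern (⊤ : SimpleGraph (Fin (r + 1)))}
    (hstep : ∀ n : ℕ, n₀ < n → ∀ (G : SimpleGraph (Fin n)) (m : ℕ),
      3 ^ (SimpleGraph.extremalNumber n (⊤ : SimpleGraph (Fin (r + 1))) + m) ≤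
        patternFreeCount 3 P G →
      (∀ p : Fin n → Fin r, ∃ u v, G.Adj u v ∧ p u = p v) →
      ∃ n' < n, n ≤ n' + 2 ∧ ∃ G' : SimpleGraph (Fin n'),
        3 ^ (SimpleGraph.extremalNumber n' (⊤ : SimpleGraph (Fin (r + 1))) + m + 1) ≤
          patternFreeCount 3 P G')
    (n : ℕ) (G : SimpleGraph (Fin n)) (m : ℕ) (hm : 1 ≤ m)
    (hc : 3 ^ (SimpleGraph.extremalNumber n (⊤ : SimpleGraph (Fin (r + 1))) + m) ≤
        patternFreeCount 3 P G) : 2 * m + n ≤ 2 * n₀ ^ 2 + n₀ := by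
  induction n using Nat.strong_induction_on generalizing m with
  | _ n ih =>
    rcases le_or_gt n n₀ with hn | hn
    · have h1 := (Nat.pow_le_pow_iff_right (by norm_num)).1 (hc.trans (patternFreeCount_le 3 P G))
      have h2 := G.card_edgeFinset_le_card_choose_two
      rw [Fintype.card_fin] at h2
      have h3 : n.choose 2 ≤ n ^ 2 := Nat.choose_le_pow n 2
      have h4 := Nat.pow_le_pow_left hn 2
      have h5 : m ≤ n₀ ^ 2 := by
        refine le_trans ?_ (h2.trans (h3.trans h4))
        omega
      omega
    -- As `m` is positive, `G` has more colourings than an `r`-partite graph can have.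
    · have hpart : ∀ p : Fin n → Fin r, ∃ u v, G.Adj u v ∧ p u = p v := by
        intro p
        by_contra! h
        obtain ⟨h1, h2⟩ := patternFreeCount_eq_of_partite (s := 3) (P := P) h
        rw [Fintype.card_fin] at h2
        rw [h1] at hc
        have := (Nat.pow_le_pow_iff_right (by norm_num)).1 hc
        omega
      obtain ⟨n', hn', hn2, G', hG'⟩ := hstep n hn G m hc hpart
      have := ih n' hn' G' (m + 1) (by omega) (by rwa [← add_assoc])
      omega

theorem exists_nonempty_iso_turanGraph_of_pow_le {r : ℕ} (hr : 2 ≤ r)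
    {P : EdgePattern (⊤ : SimpleGraph (Fin (r + 1)))} (hP : ThreeStability P) :
    ∃ n₀ : ℕ, ∀ n : ℕ, n₀ ≤ n → ∀ G : SimpleGraph (Fin n),
      3 ^ SimpleGraph.extremalNumber n (⊤ : SimpleGraph (Fin (r + 1))) ≤ patternFreeCount 3 P G →
        Nonempty (G ≃g SimpleGraph.turanGraph n r) := by
  obtain ⟨n₀, hstep⟩ := exists_smaller_of_not_partite hr hP
  have : Nontrivial (Fin (r + 1)) := Fin.nontrivial_iff_two_le.2 (by omega)
  refine ⟨2 * n₀ ^ 2 + n₀ + 1, fun n hn G hc => ?_⟩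
  have hpart : ∃ p : Fin n → Fin r, ∀ u v, G.Adj u v → p u ≠ p v := by
    by_contra! h
    obtain ⟨n', hn', hn2, G', hG'⟩ := hstep n (by omega) G 0 hc h
    have := two_mul_add_le_of_pow_le hstep n' G' 1 le_rfl hG'
    omega
  obtain ⟨p, hp⟩ := hpart
  obtain ⟨h1, h2⟩ := patternFreeCount_eq_of_partite (s := 3) (P := P) hp
  rw [h1] at hc
  have h3 := (Nat.pow_le_pow_iff_right (by norm_num)).1 hc
  have h4 := (SimpleGraph.card_edgeFinset_eq_extremalNumber_top_iff_nonempty_iso_turanGraph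
    (G := G) (α := Fin (r + 1))).1 ⟨free_of_hom hp, le_antisymm h2 (by simpa using h3)⟩
  rwa [Fintype.card_fin, Fintype.card_fin, Nat.add_sub_cancel] at h4

theorem patternFreeCount_of_iso_turanGraph {r n s : ℕ} (hr : 1 ≤ r)
    (P : EdgePattern (⊤ : SimpleGraph (Fin (r + 1)))) {G : SimpleGraph (Fin n)}
    (hG : Nonempty (G ≃g SimpleGraph.turanGraph n r)) :
    patternFreeCount s P G =
      s ^ SimpleGraph.extremalNumber n (⊤ : SimpleGraph (Fin (r + 1))) := by
  have : Nontrivial (Fin (r + 1)) := Fin.nontrivial_iff_two_le.2 (by omega)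
  obtain ⟨h1, h2⟩ := (SimpleGraph.card_edgeFinset_eq_extremalNumber_top_iff_nonempty_iso_turanGraph
    (G := G) (α := Fin (r + 1))).2
      (by rwa [Fintype.card_fin, Fintype.card_fin, Nat.add_sub_cancel])
  rw [patternFreeCount_of_free s P h1, h2, Fintype.card_fin]

end PatternFreeColourings

theorem mainTheorem4 (k : ℕ) (hk : 3 ≤ k) (P : EdgePattern (⊤ : SimpleGraph (Fin k)))
    (hP : ThreeStability P) :
    ∃ n₀ : ℕ, ∀ n : ℕ, n₀ ≤ n → ∀ G : SimpleGraph (Fin n),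
      patternFreeCount 3 P G = maxPatternFreeCount 3 P n ↔
        Nonempty (G ≃g SimpleGraph.turanGraph n (k - 1)) := by
  obtain ⟨r, rfl⟩ : ∃ r, k = r + 1 := ⟨k - 1, by omega⟩
  rw [Nat.add_sub_cancel]
  obtain ⟨n₀, hn₀⟩ := exists_nonempty_iso_turanGraph_of_pow_le (by omega) hP
  refine ⟨n₀, fun n hn G => ?_⟩
  obtain ⟨⟨G₀, hG₀⟩, hmax⟩ := isGreatest_maxPatternFreeCount 3 P n
  have hturan := patternFreeCount_of_iso_turanGraph (s := 3) (by omega) P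
    (⟨SimpleGraph.Iso.refl⟩ :
      Nonempty (SimpleGraph.turanGraph n r ≃g SimpleGraph.turanGraph n r))
  have hle := hmax ⟨SimpleGraph.turanGraph n r, rfl⟩
  simp only at hG₀ hle
  rw [hturan] at hle
  constructor
  · intro h
    exact hn₀ n hn G (h ▸ hle)
  · intro h
    -- A maximiser `G₀` is isomorphic to the Turán graph as well, which determines the maximum.
    rw [patternFreeCount_of_iso_turanGraph (by omega) P h, ← hG₀,
      patternFreeCount_of_iso_turanGraph (by omega) P (hn₀ n hn G₀ (hG₀ ▸ hle))]
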